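/- **Theorem (existence and uniqueness).** Consider on $\mathbb R^3$ the Boussinesq system $$\partial_t u+u\cdot\nabla u+\nabla P=\Delta u+\theta e_3,\qquad \operatorname{div}u=0,\qquad \partial_t\theta+u\cdot\nabla\theta=\Delta\theta,\qquad u(0)=u_0,\ \theta(0)=\theta_0,$$ where $e_3=(0,0,1)^T$. Let $\mathbb P=\mathrm{Id}+\nabla(-\Delta)^{-1}\operatorname{div}$ be the Leray projector, and for (Lebesgue) measurable $u:(0,\infty)\times\mathbb R^3\to\mathbb R^3$ and $\theta:(0,\infty)\times\mathbb R^3\to\mathbb R$ put $$\|u\|_{\mathcal X}=\sup_{t>0,\,x\in\mathbb R^3}(\sqrt t+|x|)\,|u(t,x)|,\qquad \|\theta\|_{\mathcal Y}=\sup_{t>0,\,x\in\mathbb R^3}(\sqrt t+|x|)^3\,|\theta(t,x)|;$$ $\mathcal X$ and $\mathcal Y$ are the spaces of such functions with finite norm. A pair $(u,\theta)\in\mathcal X\times\mathcal Y$ is a *mild solution* with data $(u_0,\theta_0)$ if, for all $t>0$ and $x\in\mathbb R^3$, $$u(t)=e^{t\Delta}u_0+t e^{t\Delta}\mathbb P(\theta_0e_3)-\int_0^t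 e^{(t-s)\Delta}\mathbb P\nabla\cdot(u\otimes u)(s)\,ds-\int_0^t(t-s)e^{(t-s)\Delta}\mathbb P\big(\nabla\cdot(\theta u)(s)\,e_3\big)\,ds,$$ $$\theta(t)=e^{t\Delta}\theta_0-\int_0^t e^{(t-s)\Delta}\nabla\cdot(\theta u)(s)\,ds,$$ where $e^{t\Delta}\nabla\cdot$ and $e^{t\Delta}\mathbb P\nabla\cdot$ denote convolution with the corresponding first derivatives of the kernels of $e^{t\Delta}$ and $e^{t\Delta}\mathbb P$. There are absolute constants $\epsilon_0>0$ and $C>0$ such that the following holds for every $0<\epsilon\le\epsilon_0$. Let $u_0:\mathbb R^3\to\mathbb R^3$ be a measurable vector field which is divergence-free in the sense of distributions, let $\theta_0$ be a real tempered distribution on $\mathbb R^3$, and suppose that $$\sup_{x\in\mathbb R^3}|x||u_0(x)|<\epsilon,\qquad \|te^{t\Delta}\mathbb P(\theta_0e_3)\|_{\mathcal X}<\epsilon,\qquad \|e^{t\Delta}\theta_0\|_{\mathcal Y}<\epsilon.$$ (Here $e^{t\Delta}\mathbb P(\theta_0e_3)$ is understood as $e^{\frac t2\Delta}\mathbb P\big((e^{\frac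 t2\Delta}\theta_0)e_3\big)$.) Then there is a mild solution $(u,\theta)\in\mathcal X\times\mathcal Y$ with data $(u_0,\theta_0)$ such that $$\|u\|_{\mathcal X}\le C\epsilon,\qquad \|\theta\|_{\mathcal Y}\le C\epsilon,$$ and $u(t)$ is divergence-free in the sense of distributions for every $t>0$. It is unique: every mild solution $(v,\eta)\in\mathcal X\times\mathcal Y$ with the same data and $\|v\|_{\mathcal X}\le C\epsilon$, $\|\eta\|_{\mathcal Y}\le C\epsilon$ satisfies $v(t,x)=u(t,x)$ and $\eta(t,x)=\theta(t,x)$ for all $t>0$, $x\in\mathbb R^3$. -/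

import Mathlib

open MeasureTheory Set
open scoped ENNReal SchwartzMap ContDiff

noncomputable section

namespace Boussinesq

/-- Euclidean space `ℝ³`. -/
abbrev E3 := EuclideanSpace ℝ (Fin 3)

/-- Real tempered distributions on `ℝ³`: continuous linear functionals on the real-valued
Schwartz functions. -/
abbrev RealTempered := 𝓢(E3, ℝ) →L[ℝ] ℝ

/-- The partial derivative `∂_k f` of a scalar function on `ℝ³`. -/
def pd (k : Fin 3) (f : E3 → ℝ) (x : E3) : ℝ :=
  fderiv ℝ f x (EuclideanSpace.single k 1)

/-! ### Kernels -/

/-- The heat kernel `(4πt)^(-3/2) exp(-|x|²/(4t))`, i.e. the kernel of `e^{tΔ}`, for `t > 0`. -/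
def heatKernel (t : ℝ) (x : E3) : ℝ :=
  (4 * Real.pi * t) ^ (-(3 / 2) : ℝ) * Real.exp (-(1 / (4 * t)) * ‖x‖ ^ 2)

/-- The kernel `∫_t^∞ e^{sΔ} ds` of `(-Δ)⁻¹ e^{tΔ}`, for `t > 0`. -/
def invLaplaceHeatKernel (t : ℝ) (x : E3) : ℝ :=
  ∫ s in Ioi t, heatKernel s x

/-- The Oseen kernel: the `(j, l)` entry of the matrix kernel of `e^{tΔ} ℙ`, where
`ℙ = Id + ∇ (-Δ)⁻¹ div` is the Leray projector (the Fourier multiplier `δ_{jl} - ξ_j ξ_l / |ξ|²`). -/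
def oseenKernel (j l : Fin 3) (t : ℝ) (x : E3) : ℝ :=
  (if j = l then heatKernel t x else 0) + pd j (pd l (invLaplaceHeatKernel t)) x

/-! ### The heat kernel as a Schwartz function -/

theorem gaussian_poly_bound {a : ℝ} (ha : 0 < a) (m : ℕ) :
    ∃ C : ℝ, ∀ r : ℝ, 0 ≤ r → (1 + r) ^ m * Real.exp (-a * r ^ 2) ≤ C := by
  refine ⟨(m.factorial : ℝ) * Real.exp (1 + 1 / (4 * a)), fun r hr => ?_⟩
  have h1 : (1 + r) ^ m ≤ (m.factorial : ℝ) * Real.exp (1 + r) := by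
    have h := Real.pow_div_factorial_le_exp (1 + r) (by positivity) m
    rw [div_le_iff₀ (by positivity)] at h
    linarith
  calc (1 + r) ^ m * Real.exp (-a * r ^ 2)
      ≤ ((m.factorial : ℝ) * Real.exp (1 + r)) * Real.exp (-a * r ^ 2) := by gcongr
    _ = (m.factorial : ℝ) * Real.exp (1 + r + -a * r ^ 2) := by rw [mul_assoc, ← Real.exp_add]
    _ ≤ _ := by
        have h2 : r - a * r ^ 2 ≤ 1 / (4 * a) := by
          rw [le_div_iff₀ (by positivity)]
          nlinarith [sq_nonneg (2 * a * r - 1)]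
        refine mul_le_mul_of_nonneg_left (Real.exp_le_exp.2 ?_) (by positivity)
        linarith

theorem gaussian_decay {a : ℝ} (ha : 0 < a) (p n : ℕ) :
    ∃ C : ℝ, ∀ x : E3,
      ‖x‖ ^ p * ‖iteratedFDeriv ℝ n (fun y : E3 => Real.exp (-a * ‖y‖ ^ 2)) x‖ ≤ C := by
  have hf : Function.HasTemperateGrowth (fun y : E3 => -a * ‖y‖ ^ 2) :=
    (Function.HasTemperateGrowth.const (-a)).mul (Function.hasTemperateGrowth_norm_sq E3)
  obtain ⟨k, K, hK0, hK⟩ := hf.norm_iteratedFDeriv_le_uniform n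
  obtain ⟨C, hC⟩ := gaussian_poly_bound ha (p + k * n)
  refine ⟨n.factorial * (1 + K) ^ n * C, fun x => ?_⟩
  have hone : (1 : ℝ) ≤ 1 + ‖x‖ := by linarith [norm_nonneg x]
  have hbase : (1 : ℝ) ≤ (1 + K) * (1 + ‖x‖) ^ k := by
    have := one_le_pow₀ hone (n := k)
    nlinarith
  have hcomp := norm_iteratedFDeriv_comp_le (𝕜 := ℝ) (g := Real.exp)
    (f := fun y : E3 => -a * ‖y‖ ^ 2) (n := n) (N := (n : ℕ∞)) Real.contDiff_exp
    (hf.1.of_le (by exact_mod_cast le_top)) le_rfl x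
    (C := Real.exp (-a * ‖x‖ ^ 2)) (D := (1 + K) * (1 + ‖x‖) ^ k)
    (fun i _ => by
      rw [norm_iteratedFDeriv_eq_norm_iteratedDeriv, iteratedDeriv_eq_iterate, Real.iter_deriv_exp,
        Real.norm_of_nonneg (Real.exp_nonneg _)])
    (fun i hi hin => by
      calc ‖iteratedFDeriv ℝ i (fun y : E3 => -a * ‖y‖ ^ 2) x‖
          ≤ K * (1 + ‖x‖) ^ k := hK i hin x
        _ ≤ (1 + K) * (1 + ‖x‖) ^ k := by gcongr; linarith
        _ ≤ _ := le_self_pow₀ hbase (by omega))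
  have hxp : ‖x‖ ^ p ≤ (1 + ‖x‖) ^ p := by gcongr; linarith
  calc ‖x‖ ^ p * ‖iteratedFDeriv ℝ n (fun y : E3 => Real.exp (-a * ‖y‖ ^ 2)) x‖
      ≤ (1 + ‖x‖) ^ p * (n.factorial * Real.exp (-a * ‖x‖ ^ 2) * ((1 + K) * (1 + ‖x‖) ^ k) ^ n) := by
        gcongr
        exact hcomp
    _ = n.factorial * (1 + K) ^ n * ((1 + ‖x‖) ^ (p + k * n) * Real.exp (-a * ‖x‖ ^ 2)) := by
        rw [mul_pow, ← pow_mul, pow_add]; ring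
    _ ≤ _ := by gcongr; exact hC _ (norm_nonneg x)

/-- The Gaussian `exp(-a|x|²)`, `a > 0`, as a Schwartz function. -/
def gaussianSchwartz (a : ℝ) (ha : 0 < a) : 𝓢(E3, ℝ) where
  toFun := fun y => Real.exp (-a * ‖y‖ ^ 2)
  smooth' := Real.contDiff_exp.comp (contDiff_const.mul (contDiff_norm_sq ℝ))
  decay' := gaussian_decay ha

/-- The heat kernel at time `t > 0` as a Schwartz function (`0` by convention for `t ≤ 0`). -/
def heatSchwartz (t : ℝ) : 𝓢(E3, ℝ) :=
  if ht : 0 < t then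
    (4 * Real.pi * t) ^ (-(3 / 2) : ℝ) • gaussianSchwartz (1 / (4 * t)) (by positivity)
  else 0

theorem heatSchwartz_apply {t : ℝ} (ht : 0 < t) (x : E3) : heatSchwartz t x = heatKernel t x := by
  rw [heatSchwartz, dif_pos ht]
  rfl

/-! ### Free evolutions -/

/-- `e^{tΔ} u₀` for a vector field `u₀`. -/
def heatFlow (u₀ : E3 → E3) (t : ℝ) (x : E3) : E3 :=
  ∫ y, heatKernel t (x - y) • u₀ y

/-- `e^{tΔ} θ₀` for a tempered distribution `θ₀`: the smooth function
`x ↦ ⟨θ₀, heatKernel t (x - ·)⟩` (the heat kernel is even). -/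
def heatFlowDistr (θ₀ : RealTempered) (t : ℝ) (x : E3) : ℝ :=
  θ₀ (SchwartzMap.compSubConstCLM ℝ x (heatSchwartz t))

/-- `e^{tΔ} ℙ(θ₀ e₃)` for a tempered distribution `θ₀`. As the Oseen kernel only decays like
`|x|⁻³` it is not a Schwartz function, so the semigroup property
`e^{tΔ} ℙ (θ₀ e₃) = e^{(t/2)Δ} ℙ ((e^{(t/2)Δ} θ₀) e₃)` is used to apply the kernel to a function.
If `|e^{tΔ} θ₀(x)| ≤ C (√t + |x|)⁻³`, then the integral converges absolutely. -/
def lerayHeatFlowDistr (θ₀ : RealTempered) (t : ℝ) (x : E3) : E3 :=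
  WithLp.toLp 2 fun j =>
    ∫ y, oseenKernel j 2 (t / 2) (x - y) * heatFlowDistr θ₀ (t / 2) y

/-! ### Function spaces -/

/-- `‖u‖_𝓧 = sup_{t > 0, x} (√t + |x|) |u(t,x)|`. -/
def normX (u : ℝ → E3 → E3) : ℝ≥0∞ :=
  ⨆ (t : ℝ) (_ : 0 < t) (x : E3), ENNReal.ofReal (√t + ‖x‖) * ‖u t x‖ₑ

/-- `‖θ‖_𝓨 = sup_{t > 0, x} (√t + |x|)³ |θ(t,x)|`. -/
def normY (θ : ℝ → E3 → ℝ) : ℝ≥0∞ :=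
  ⨆ (t : ℝ) (_ : 0 < t) (x : E3), ENNReal.ofReal ((√t + ‖x‖) ^ 3) * ‖θ t x‖ₑ

/-- `u ∈ 𝓧`: (Lebesgue) measurable on `(0,∞) × ℝ³` with finite norm. -/
def MemX (u : ℝ → E3 → E3) : Prop :=
  AEStronglyMeasurable (Function.uncurry u) (volume.restrict (Ioi (0 : ℝ) ×ˢ univ)) ∧ normX u < ⊤

/-- `θ ∈ 𝓨`: (Lebesgue) measurable on `(0,∞) × ℝ³` with finite norm. -/
def MemY (θ : ℝ → E3 → ℝ) : Prop :=
  AEStronglyMeasurable (Function.uncurry θ) (volume.restrict (Ioi (0 : ℝ) ×ˢ univ)) ∧ normY θ < ⊤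

/-- `div v = 0` in the sense of distributions (for a locally integrable `v`). -/
def IsDivFree (v : E3 → E3) : Prop :=
  ∀ φ : E3 → ℝ, ContDiff ℝ ∞ φ → HasCompactSupport φ → ∫ x, fderiv ℝ φ x (v x) = 0

/-! ### Mild solutions -/

/-- `B(u,u)(t) = -∫₀ᵗ e^{(t-s)Δ} ℙ ∇·(u ⊗ u)(s) ds`, the derivative falling on the kernel. -/
def termB (u : ℝ → E3 → E3) (t : ℝ) (x : E3) : E3 :=
  WithLp.toLp 2 fun j => -∫ s in Ioo 0 t, ∫ y,
    ∑ k, ∑ l, pd k (oseenKernel j l (t - s)) (x - y) * (u s y k * u s y l)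

/-- `E(u,θ)(t) = -∫₀ᵗ (t-s) e^{(t-s)Δ} ℙ (∇·(θ u)(s) e₃) ds`, the derivative falling on the
kernel. -/
def termE (u : ℝ → E3 → E3) (θ : ℝ → E3 → ℝ) (t : ℝ) (x : E3) : E3 :=
  WithLp.toLp 2 fun j => -∫ s in Ioo 0 t, (t - s) * ∫ y,
    ∑ k, pd k (oseenKernel j 2 (t - s)) (x - y) * (θ s y * u s y k)

/-- `B̃(θ,u)(t) = -∫₀ᵗ e^{(t-s)Δ} ∇·(θ u)(s) ds`, the derivative falling on the kernel. -/
def termBt (θ : ℝ → E3 → ℝ) (u : ℝ → E3 → E3) (t : ℝ) (x : E3) : ℝ :=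
  -∫ s in Ioo 0 t, ∫ y, ∑ k, pd k (heatKernel (t - s)) (x - y) * (θ s y * u s y k)

/-- `(u, θ)` is a mild solution of the Boussinesq system with data `(u₀, θ₀)`: for all `t > 0`
and `x`, `u = e^{tΔ} u₀ + t e^{tΔ} ℙ(θ₀ e₃) + B(u,u) + E(u,θ)` and `θ = e^{tΔ} θ₀ + B̃(θ,u)`. -/
def IsMildSolution (u₀ : E3 → E3) (θ₀ : RealTempered) (u : ℝ → E3 → E3) (θ : ℝ → E3 → ℝ) : Prop :=
  ∀ t : ℝ, 0 < t → ∀ x : E3,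
    u t x = heatFlow u₀ t x + t • lerayHeatFlowDistr θ₀ t x + termB u t x + termE u θ t x ∧
    θ t x = heatFlowDistr θ₀ t x + termBt θ u t x

end Boussinesq

end

/-!
The kernels of `e^{tΔ}`, of `e^{tΔ} ℙ` and of their derivatives are parabolic rescalings
`t^(-m/2) g(x/√t)` of Schwartz functions, and integrals of such rescalings over `(t, ∞)` coming from
`(-Δ)⁻¹ = ∫₀^∞ e^{sΔ} ds`; both decay like negative powers of `√t + |x|`. Convolving the gradient of
a kernel, of size `(√t + |x|)⁻⁴`, with a source of size `(√s + |y|)⁻ⁿ`, `n = 2` or `n = 4`, and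
integrating in time gains a factor `√t`, or `√t³` with the additional weight `t - s`. This is
exactly what the quadratic terms need to map `𝓧 × 𝓨` to itself, with a bound quadratic in the norm,
so for small data the mild formulation is a fixed point equation for a contraction of a ball of
`𝓧 × 𝓨`. The velocity is divergence-free because every term of its Duhamel formula is a
superposition of translates of divergence-free columns of the Oseen kernel or of `u₀`.
-/

noncomputable section

namespace Boussinesq

open Filter Topology LineDeriv

/-! ### Parabolic rescaling of Schwartz functions -/

section Parabolic

variable {V F : Type*} [NormedAddCommGroup V] [NormedAddCommGroup F]

/-- `|f(t,x)| ≤ C (√t + |x|)⁻ⁿ` for `t > 0`. With `n = 1` and `n = 3` these are the balls of `𝓧` and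
`𝓨`; the kernels of the system satisfy such bounds as well. -/
def ParabolicDecay (f : ℝ → V → F) (n : ℕ) (C : ℝ) : Prop :=
  ∀ t : ℝ, 0 < t → ∀ x, ‖f t x‖ ≤ C * ((√t + ‖x‖) ^ n)⁻¹

theorem ParabolicDecay.mono {f : ℝ → V → F} {n : ℕ} {C D : ℝ} (h : ParabolicDecay f n C)
    (hCD : C ≤ D) : ParabolicDecay f n D :=
  fun t ht x => (h t ht x).trans (by gcongr)

theorem ParabolicDecay.add {f g : ℝ → V → F} {n : ℕ} {C D : ℝ} (hf : ParabolicDecay f n C)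
    (hg : ParabolicDecay g n D) : ParabolicDecay (fun t x => f t x + g t x) n (C + D) :=
  fun t ht x => (norm_add_le_of_le (hf t ht x) (hg t ht x)).trans_eq (add_mul ..).symm

theorem ParabolicDecay.sub {f g : ℝ → V → F} {n : ℕ} {C D : ℝ} (hf : ParabolicDecay f n C)
    (hg : ParabolicDecay g n D) : ParabolicDecay (fun t x => f t x - g t x) n (C + D) :=
  fun t ht x => (norm_sub_le_of_le (hf t ht x) (hg t ht x)).trans_eq (add_mul ..).symm

theorem ParabolicDecay.const_nonneg {f : ℝ → V → F} {n : ℕ} {C : ℝ}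
    (hf : ParabolicDecay f n C) : 0 ≤ C :=
  nonneg_of_mul_nonneg_left ((norm_nonneg _).trans (hf 1 one_pos 0)) (by simp)

variable [NormedSpace ℝ V] [NormedSpace ℝ F]

/-- The parabolic rescaling `s^(-m/2) g(x/√s)` of a profile `g`; the heat kernel is the case
`m = 3`, and each space derivative raises `m` by one. -/
def rescale (m : ℕ) (g : 𝓢(V, F)) (s : ℝ) (x : V) : F :=
  (√s ^ m)⁻¹ • g ((√s)⁻¹ • x)

/-- The integral over `s > t` of a parabolic rescaling; it is the kernel of `(-Δ)⁻¹ e^{tΔ}`, or of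
one of its derivatives, when `g` is a Gaussian or a derivative of it. -/
def tail (m : ℕ) (g : 𝓢(V, F)) (t : ℝ) (x : V) : F :=
  ∫ s in Ioi t, rescale m g s x

theorem exists_parabolicDecay_rescale (m : ℕ) (g : 𝓢(V, F)) :
    ∃ C, 0 ≤ C ∧ ParabolicDecay (rescale m g) m C := by
  set C := 2 ^ m * ((Finset.Iic (m, 0)).sup fun q => SchwartzMap.seminorm ℝ q.1 q.2) g
  refine ⟨C, by positivity, fun s hs x => ?_⟩
  have hσ : 0 < √s := Real.sqrt_pos.2 hs
  have hz : √s * (1 + ‖(√s)⁻¹ • x‖) = √s + ‖x‖ := by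
    rw [norm_smul, norm_inv, Real.norm_of_nonneg hσ.le]
    field_simp
  have hg : (1 + ‖(√s)⁻¹ • x‖) ^ m * ‖g ((√s)⁻¹ • x)‖ ≤ C := by
    simpa using SchwartzMap.one_add_le_sup_seminorm_apply (𝕜 := ℝ) (m := (m, 0)) le_rfl le_rfl g
      ((√s)⁻¹ • x)
  rw [rescale, norm_smul, norm_inv, norm_pow, Real.norm_of_nonneg hσ.le, ← hz, mul_pow, mul_inv,
    mul_left_comm]
  gcongr
  rwa [le_mul_inv_iff₀ (by positivity), mul_comm]

theorem hasFDerivAt_rescale (m : ℕ) (g : 𝓢(V, F)) (s : ℝ) (x : V) :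
    HasFDerivAt (rescale m g s) (rescale (m + 1) (SchwartzMap.fderivCLM ℝ V F g) s x) x := by
  have hscale : HasFDerivAt (fun y : V => (√s)⁻¹ • y) ((√s)⁻¹ • ContinuousLinearMap.id ℝ V) x :=
    (hasFDerivAt_id x).const_smul _
  refine (((g.hasFDerivAt _).comp x hscale).const_smul (√s ^ m)⁻¹).congr_fderiv ?_
  ext v
  simp [rescale, pow_succ, smul_smul, mul_comm]

theorem fderiv_rescale_apply (m : ℕ) (g : 𝓢(V, F)) (s : ℝ) (x v : V) :
    fderiv ℝ (rescale m g s) x v = rescale (m + 1) (∂_{v} g) s x := by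
  rw [(hasFDerivAt_rescale m g s x).fderiv]
  rfl

theorem contDiff_rescale (m : ℕ) (g : 𝓢(V, F)) (s : ℝ) : ContDiff ℝ 1 (rescale m g s) :=
  ((g.smooth 1).comp (contDiff_const_smul _)).const_smul _

theorem stronglyMeasurable_rescale_time (m : ℕ) (g : 𝓢(V, F)) (x : V) :
    StronglyMeasurable fun s => rescale m g s x :=
  (Measurable.stronglyMeasurable (by fun_prop)).smul
    (g.continuous.comp_stronglyMeasurable
      ((Measurable.stronglyMeasurable (by fun_prop : Measurable fun s : ℝ => (√s)⁻¹)).smul_const x))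

theorem stronglyMeasurable_rescale [MeasurableSpace V] [BorelSpace V] [SecondCountableTopology V]
    (m : ℕ) (g : 𝓢(V, F)) : StronglyMeasurable fun p : ℝ × V => rescale m g p.1 p.2 :=
  (Measurable.stronglyMeasurable (by fun_prop)).smul
    (g.continuous.comp_stronglyMeasurable (Measurable.stronglyMeasurable (by fun_prop)))

theorem hasDerivAt_sqrt_add_pow_inv (n : ℕ) {s ρ : ℝ} (hs : 0 < s) (hρ : 0 ≤ ρ) :
    HasDerivAt (fun s => ((√s + ρ) ^ (n + 1))⁻¹)
      (-((n + 1) * ((√s + ρ) ^ (n + 2))⁻¹ / (2 * √s))) s := by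
  have := Real.sqrt_pos.2 hs
  refine ((((Real.hasDerivAt_sqrt hs.ne').add_const ρ).pow (n + 1)).inv
    (by simp only [Pi.pow_apply]; positivity)).congr_deriv ?_
  simp only [Nat.add_sub_cancel, Pi.pow_apply]
  push_cast
  field_simp
  ring

theorem tendsto_sqrt_add_pow_inv (n : ℕ) (ρ : ℝ) :
    Tendsto (fun s => ((√s + ρ) ^ (n + 1))⁻¹) atTop (𝓝 0) :=
  tendsto_inv_atTop_zero.comp ((tendsto_pow_atTop n.succ_ne_zero).comp
    (tendsto_atTop_add_const_right _ _ Real.tendsto_sqrt_atTop))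

theorem sqrt_add_pow_inv_le (n : ℕ) {s ρ : ℝ} (hs : 0 < s) (hρ : 0 ≤ ρ) :
    ((√s + ρ) ^ (n + 3))⁻¹ ≤ -2 * -((n + 1) * ((√s + ρ) ^ (n + 2))⁻¹ / (2 * √s)) := by
  have := Real.sqrt_pos.2 hs
  have hle : (√s + ρ)⁻¹ ≤ (√s)⁻¹ := by gcongr; linarith
  have hn : (1 : ℝ) ≤ n + 1 := by linarith [n.cast_nonneg (α := ℝ)]
  calc ((√s + ρ) ^ (n + 3))⁻¹ = 1 * ((√s + ρ) ^ (n + 2))⁻¹ * (√s + ρ)⁻¹ := by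
        rw [pow_succ, mul_inv, one_mul]
    _ ≤ (n + 1) * ((√s + ρ) ^ (n + 2))⁻¹ * (√s)⁻¹ := by gcongr
    _ = _ := by field_simp

theorem integrableOn_and_integral_sqrt_add_pow_inv_le (n : ℕ) {t ρ : ℝ} (ht : 0 < t) (hρ : 0 ≤ ρ) :
    IntegrableOn (fun s => ((√s + ρ) ^ (n + 3))⁻¹) (Ioi t) ∧
      ∫ s in Ioi t, ((√s + ρ) ^ (n + 3))⁻¹ ≤ 2 * ((√t + ρ) ^ (n + 1))⁻¹ := by
  have hderiv := fun s (hs : s ∈ Ici t) => hasDerivAt_sqrt_add_pow_inv n (ht.trans_le hs) hρ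
  have hneg : ∀ s ∈ Ioi t, -((n + 1) * ((√s + ρ) ^ (n + 2))⁻¹ / (2 * √s)) ≤ 0 := fun s _ =>
    neg_nonpos.2 (by positivity)
  have hlim := tendsto_sqrt_add_pow_inv n ρ
  have hdom := (integrableOn_Ioi_deriv_of_nonpos' hderiv hneg hlim).const_mul (-2)
  have hle := fun s (hs : s ∈ Ioi t) => sqrt_add_pow_inv_le n (ht.trans hs) hρ
  have hint : IntegrableOn (fun s => ((√s + ρ) ^ (n + 3))⁻¹) (Ioi t) := by
    refine hdom.mono' (Measurable.aestronglyMeasurable (by fun_prop)) ?_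
    filter_upwards [ae_restrict_mem measurableSet_Ioi] with s hs
    rw [Real.norm_of_nonneg (by positivity)]
    exact hle s hs
  refine ⟨hint, (setIntegral_mono_on hint hdom measurableSet_Ioi hle).trans_eq ?_⟩
  rw [integral_const_mul, integral_Ioi_of_hasDerivAt_of_nonpos' hderiv hneg hlim]
  ring

theorem integrableOn_rescale (m : ℕ) (g : 𝓢(V, F)) {t : ℝ} (ht : 0 < t) (x : V) :
    IntegrableOn (fun s => rescale (m + 3) g s x) (Ioi t) := by
  obtain ⟨C, -, hC⟩ := exists_parabolicDecay_rescale (m + 3) g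
  refine ((integrableOn_and_integral_sqrt_add_pow_inv_le m ht (norm_nonneg x)).1.const_mul C).mono'
    (stronglyMeasurable_rescale_time _ g x).aestronglyMeasurable ?_
  filter_upwards [ae_restrict_mem measurableSet_Ioi] with s hs
  exact hC s (ht.trans hs) x

theorem exists_parabolicDecay_tail (m : ℕ) (g : 𝓢(V, F)) :
    ∃ C, 0 ≤ C ∧ ParabolicDecay (tail (m + 3) g) (m + 1) C := by
  obtain ⟨C, hC0, hC⟩ := exists_parabolicDecay_rescale (m + 3) g
  refine ⟨C * 2, by positivity, fun t ht x => ?_⟩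
  obtain ⟨hint, hle⟩ := integrableOn_and_integral_sqrt_add_pow_inv_le m ht (norm_nonneg x)
  calc ‖tail (m + 3) g t x‖
      ≤ ∫ s in Ioi t, C * ((√s + ‖x‖) ^ (m + 3))⁻¹ :=
        norm_integral_le_of_norm_le (hint.const_mul C) <|
          (ae_restrict_mem measurableSet_Ioi).mono fun s hs => hC s (ht.trans hs) x
    _ ≤ C * (2 * ((√t + ‖x‖) ^ (m + 1))⁻¹) := by
        rw [integral_const_mul]
        gcongr
    _ = _ := (mul_assoc ..).symm

theorem hasFDerivAt_tail (m : ℕ) (g : 𝓢(V, F)) {t : ℝ} (ht : 0 < t) (x : V) :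
    HasFDerivAt (tail (m + 3) g t)
      (tail (m + 4) (SchwartzMap.fderivCLM ℝ V F g) t x) x := by
  obtain ⟨C, hC0, hC⟩ := exists_parabolicDecay_rescale (m + 4) (SchwartzMap.fderivCLM ℝ V F g)
  refine hasFDerivAt_integral_of_dominated_of_fderiv_le
    (bound := fun s => C * ((√s + 0) ^ (m + 4))⁻¹) univ_mem
    (Eventually.of_forall fun y => (stronglyMeasurable_rescale_time _ g y).aestronglyMeasurable)
    (integrableOn_rescale m g ht x)
    (stronglyMeasurable_rescale_time _ _ x).aestronglyMeasurable ?_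
    ((integrableOn_and_integral_sqrt_add_pow_inv_le (m + 1) ht le_rfl).1.const_mul C)
    (ae_of_all _ fun s y _ => hasFDerivAt_rescale _ g s y)
  filter_upwards [ae_restrict_mem measurableSet_Ioi] with s hs y _
  have := Real.sqrt_pos.2 (ht.trans hs)
  refine (hC s (ht.trans hs) y).trans ?_
  gcongr
  exact norm_nonneg y

theorem contDiff_tail (m : ℕ) (g : 𝓢(V, F)) {t : ℝ} (ht : 0 < t) :
    ContDiff ℝ 1 (tail (m + 3) g t) := by
  refine contDiff_one_iff_fderiv.2 ⟨fun x => (hasFDerivAt_tail m g ht x).differentiableAt, ?_⟩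
  rw [funext fun x => (hasFDerivAt_tail m g ht x).fderiv]
  exact continuous_iff_continuousAt.2 fun x => (hasFDerivAt_tail (m + 1) _ ht x).continuousAt

theorem fderiv_tail_apply (m : ℕ) (g : 𝓢(V, F)) {t : ℝ} (ht : 0 < t) (x v : V) :
    fderiv ℝ (tail (m + 3) g t) x v = tail (m + 4) (∂_{v} g) t x := by
  rw [(hasFDerivAt_tail m g ht x).fderiv]
  exact ContinuousLinearMap.integral_apply
    (integrableOn_rescale (m + 1) (SchwartzMap.fderivCLM ℝ V F g) ht x) v

theorem stronglyMeasurable_tail [MeasurableSpace V] [BorelSpace V] [SecondCountableTopology V]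
    (m : ℕ) (g : 𝓢(V, F)) : StronglyMeasurable fun p : ℝ × V => tail m g p.1 p.2 := by
  have hset : MeasurableSet {q : (ℝ × V) × ℝ | q.1.1 < q.2} :=
    measurableSet_lt measurable_fst.fst measurable_snd
  have hind := ((stronglyMeasurable_rescale m g).comp_measurable
    (by fun_prop : Measurable fun q : (ℝ × V) × ℝ => (q.2, q.1.2))).indicator hset
  convert hind.integral_prod_right' (ν := volume) using 2 with p
  exact (integral_indicator (s := Ioi p.1) (f := fun s => rescale m g s p.2)
    measurableSet_Ioi).symm

end Parabolic

/-! ### The heat and Oseen kernels -/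

theorem lineDeriv_comm {V F : Type*} [NormedAddCommGroup V] [NormedSpace ℝ V]
    [NormedAddCommGroup F] [NormedSpace ℝ F] (v w : V) (g : 𝓢(V, F)) :
    ∂_{v} (∂_{w} g) = ∂_{w} (∂_{v} g) := by
  have happly (a b x : V) : (∂_{a} (∂_{b} g)) x = fderiv ℝ (fderiv ℝ g) x a b := by
    have h := (SchwartzMap.fderivCLM ℝ V F g).differentiableAt.hasFDerivAt.clm_apply
      (hasFDerivAt_const b x)
    exact (congrArg (· a) h.fderiv).trans (by simp; rfl)
  ext x
  rw [happly, happly]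
  exact (g.smooth 2).contDiffAt.isSymmSndFDerivAt (by simp) v w

/-- The standard basis vectors of `ℝ³`. -/
abbrev e (k : Fin 3) : E3 := EuclideanSpace.single k 1

theorem heatKernel_eq_rescale {t : ℝ} (ht : 0 < t) :
    heatKernel t = rescale 3 (heatSchwartz 1) t := by
  ext x
  have hσ : √t ^ 2 = t := Real.sq_sqrt ht.le
  have hpow : t ^ (-(3 / 2) : ℝ) = (√t ^ 3)⁻¹ := by
    rw [Real.sqrt_eq_rpow, ← Real.rpow_natCast, ← Real.rpow_mul ht.le, ← Real.rpow_neg ht.le]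
    norm_num
  rw [rescale, heatSchwartz_apply one_pos, heatKernel, heatKernel, Real.mul_rpow (by positivity)
    ht.le, hpow, norm_smul, mul_pow, norm_inv, Real.norm_eq_abs, inv_pow, sq_abs, hσ, smul_eq_mul]
  ring_nf

theorem invLaplaceHeatKernel_eq_tail {t : ℝ} (ht : 0 < t) :
    invLaplaceHeatKernel t = tail 3 (heatSchwartz 1) t :=
  funext fun x => setIntegral_congr_fun measurableSet_Ioi fun _ hs =>
    congrFun (heatKernel_eq_rescale (ht.trans hs)) x

theorem pd_rescale (m : ℕ) (g : 𝓢(E3, ℝ)) (k : Fin 3) (t : ℝ) (x : E3) :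
    pd k (rescale m g t) x = rescale (m + 1) (∂_{e k} g) t x :=
  fderiv_rescale_apply m g t x _

theorem pd_tail (m : ℕ) (g : 𝓢(E3, ℝ)) (k : Fin 3) {t : ℝ} (ht : 0 < t) (x : E3) :
    pd k (tail (m + 3) g t) x = tail (m + 4) (∂_{e k} g) t x :=
  fderiv_tail_apply m g ht x _

/-- The `(j, l)` entry of the kernel of `ℙ` composed with the convolution by `rescale (m + 3) g`,
for a Gaussian derivative `g` of order `m`: the Oseen kernel for `m = 0` and `∂_k` of it for `m = 1`
and `g = ∂_k` of a Gaussian. -/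
def lerayKernel (m : ℕ) (g : 𝓢(E3, ℝ)) (j l : Fin 3) (t : ℝ) (x : E3) : ℝ :=
  (if j = l then rescale (m + 3) g t x else 0) + tail (m + 5) (∂_{e j} (∂_{e l} g)) t x

theorem oseenKernel_eq_lerayKernel (j l : Fin 3) {t : ℝ} (ht : 0 < t) :
    oseenKernel j l t = lerayKernel 0 (heatSchwartz 1) j l t := by
  ext x
  have hpd : pd l (invLaplaceHeatKernel t) = tail 4 (∂_{e l} (heatSchwartz 1)) t := by
    rw [invLaplaceHeatKernel_eq_tail ht]
    exact funext fun y => pd_tail 0 _ l ht y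
  rw [oseenKernel, lerayKernel, hpd, heatKernel_eq_rescale ht, pd_tail 1 _ j ht]

theorem contDiff_lerayKernel (m : ℕ) (g : 𝓢(E3, ℝ)) (j l : Fin 3) {t : ℝ} (ht : 0 < t) :
    ContDiff ℝ 1 (lerayKernel m g j l t) := by
  have htail := contDiff_tail (m + 2) (∂_{e j} (∂_{e l} g)) ht
  refine ContDiff.add ?_ htail
  split_ifs
  · exact contDiff_rescale (m + 3) g t
  · exact contDiff_const

theorem pd_lerayKernel (m : ℕ) (g : 𝓢(E3, ℝ)) (k j l : Fin 3) {t : ℝ} (ht : 0 < t) (x : E3) :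
    pd k (lerayKernel m g j l t) x = lerayKernel (m + 1) (∂_{e k} g) j l t x := by
  have htail := (contDiff_tail (m + 2) (∂_{e j} (∂_{e l} g)) ht).differentiable one_ne_zero x
  have hlocal : pd k (fun y => if j = l then rescale (m + 3) g t y else 0) x =
      if j = l then rescale (m + 4) (∂_{e k} g) t x else 0 := by
    split_ifs
    · exact pd_rescale (m + 3) g k t x
    · simp [pd]
  have hdiff : DifferentiableAt ℝ (fun y => if j = l then rescale (m + 3) g t y else 0) x := by
    split_ifs
    · exact (contDiff_rescale (m + 3) g t).differentiable one_ne_zero x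
    · exact differentiableAt_const 0
  calc pd k (lerayKernel m g j l t) x
      = pd k (fun y => if j = l then rescale (m + 3) g t y else 0) x
          + pd k (tail (m + 5) (∂_{e j} (∂_{e l} g)) t) x :=
        congrArg (· (e k)) (fderiv_fun_add hdiff htail)
    _ = lerayKernel (m + 1) (∂_{e k} g) j l t x := by
        rw [hlocal, pd_tail (m + 2) _ k ht, lineDeriv_comm (e k) (e j), lineDeriv_comm (e k) (e l)]
        rfl

theorem exists_parabolicDecay_lerayKernel (m : ℕ) (g : 𝓢(E3, ℝ)) (j l : Fin 3) :
    ∃ C, 0 ≤ C ∧ ParabolicDecay (lerayKernel m g j l) (m + 3) C := by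
  obtain ⟨A, hA0, hA⟩ := exists_parabolicDecay_rescale (m + 3) g
  obtain ⟨B, hB0, hB⟩ := exists_parabolicDecay_tail (m + 2) (∂_{e j} (∂_{e l} g))
  refine ⟨A + B, by positivity, ParabolicDecay.add (fun t ht x => ?_) hB⟩
  split_ifs
  · exact hA t ht x
  · rw [norm_zero]
    positivity

theorem measurable_lerayKernel (m : ℕ) (g : 𝓢(E3, ℝ)) (j l : Fin 3) :
    Measurable fun p : ℝ × E3 => lerayKernel m g j l p.1 p.2 := by
  refine Measurable.add ?_ (stronglyMeasurable_tail _ _).measurable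
  split_ifs
  · exact (stronglyMeasurable_rescale _ g).measurable
  · exact measurable_const

theorem hasFDerivAt_heatSchwartz (x : E3) :
    HasFDerivAt (heatSchwartz 1) ((-(1 / 2) * heatSchwartz 1 x) • innerSL ℝ x) x := by
  refine ((((hasStrictFDerivAt_norm_sq x).hasFDerivAt.const_mul (-(1 / (4 * 1)))).exp.const_mul
    ((4 * Real.pi * 1) ^ (-(3 / 2) : ℝ))).congr_of_eventuallyEq
    (.of_forall fun y => heatSchwartz_apply one_pos y)).congr_fderiv ?_
  ext v
  simp only [heatSchwartz_apply one_pos, heatKernel, smul_apply, smul_eq_mul, nsmul_eq_mul]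
  push_cast
  ring

theorem lineDeriv_heatSchwartz (v x : E3) :
    (∂_{v} (heatSchwartz 1)) x = -(1 / 2) * heatSchwartz 1 x * inner ℝ x v :=
  congrArg (· v) (hasFDerivAt_heatSchwartz x).fderiv

theorem lineDeriv_lineDeriv_heatSchwartz (v x : E3) :
    (∂_{v} (∂_{v} (heatSchwartz 1))) x =
      ((inner ℝ x v) ^ 2 / 4 - ‖v‖ ^ 2 / 2) * heatSchwartz 1 x := by
  have h := ((hasFDerivAt_heatSchwartz x).const_mul (-(1 / 2))).mul
    ((hasFDerivAt_id x).inner ℝ (hasFDerivAt_const v x))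
  rw [SchwartzMap.lineDerivOp_apply_eq_fderiv, funext (lineDeriv_heatSchwartz v)]
  refine (congrArg (· v) h.fderiv).trans ?_
  simp
  ring

theorem sum_lineDeriv_lineDeriv_heatSchwartz (x : E3) :
    ∑ j, (∂_{e j} (∂_{e j} (heatSchwartz 1))) x = (‖x‖ ^ 2 / 4 - 3 / 2) * heatSchwartz 1 x := by
  simp only [lineDeriv_lineDeriv_heatSchwartz, EuclideanSpace.inner_single_right,
    PiLp.norm_single, EuclideanSpace.norm_sq_eq x, Fin.sum_univ_three]
  simp
  ring

theorem hasDerivAt_heatKernel_time {s : ℝ} (hs : 0 < s) (x : E3) :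
    HasDerivAt (fun r => heatKernel r x)
      ((‖x‖ ^ 2 / (4 * s ^ 2) - 3 / (2 * s)) * heatKernel s x) s := by
  have hp : 0 < 4 * Real.pi * s := by positivity
  have hpow := ((hasDerivAt_id s).const_mul (4 * Real.pi)).rpow_const (p := (-(3 / 2) : ℝ))
    (Or.inl hp.ne')
  have hexp : HasDerivAt (fun r : ℝ => -(1 / (4 * r)) * ‖x‖ ^ 2)
      (1 / (4 * s ^ 2) * ‖x‖ ^ 2) s := by
    refine ((((hasDerivAt_inv hs.ne').const_mul (-(1 / 4 : ℝ))).mul_const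
      (‖x‖ ^ 2)).congr_of_eventuallyEq (.of_forall fun r => ?_)).congr_deriv ?_
    · simp only [one_div, mul_inv]; ring
    · field_simp
  refine (hpow.mul hexp.exp).congr_deriv ?_
  simp only [id, Real.rpow_sub_one hp.ne', heatKernel]
  field_simp
  ring

theorem hasDerivAt_rescale_heatSchwartz {s : ℝ} (hs : 0 < s) (x : E3) :
    HasDerivAt (fun r => rescale 3 (heatSchwartz 1) r x)
      (∑ j, rescale 5 (∂_{e j} (∂_{e j} (heatSchwartz 1))) s x) s := by
  have hσ : √s ^ 2 = s := Real.sq_sqrt hs.le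
  have hσ0 : √s ≠ 0 := (Real.sqrt_pos.2 hs).ne'
  refine ((hasDerivAt_heatKernel_time hs x).congr_of_eventuallyEq ?_).congr_deriv ?_
  · filter_upwards [lt_mem_nhds hs] with r hr
    rw [heatKernel_eq_rescale hr]
  · have hsum : ∑ j, rescale 5 (∂_{e j} (∂_{e j} (heatSchwartz 1))) s x = (√s ^ 5)⁻¹ *
        ((‖(√s)⁻¹ • x‖ ^ 2 / 4 - 3 / 2) * heatSchwartz 1 ((√s)⁻¹ • x)) := by
      rw [← sum_lineDeriv_lineDeriv_heatSchwartz, Finset.mul_sum]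
      rfl
    rw [hsum, heatKernel_eq_rescale hs, rescale, smul_eq_mul, norm_smul, norm_inv,
      Real.norm_of_nonneg (Real.sqrt_nonneg s), mul_pow, inv_pow, hσ,
      show √s ^ 5 = √s ^ 3 * √s ^ 2 by ring, hσ]
    field_simp

theorem rescale_heatSchwartz_add_sum_tail {t : ℝ} (ht : 0 < t) (x : E3) :
    rescale 3 (heatSchwartz 1) t x +
      ∑ j, tail 5 (∂_{e j} (∂_{e j} (heatSchwartz 1))) t x = 0 := by
  obtain ⟨C, -, hC⟩ := exists_parabolicDecay_rescale 3 (heatSchwartz 1)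
  have hlim : Tendsto (fun s => rescale 3 (heatSchwartz 1) s x) atTop (𝓝 0) := by
    refine squeeze_zero_norm' ?_ (by simpa using (tendsto_sqrt_add_pow_inv 2 ‖x‖).const_mul C)
    filter_upwards [eventually_gt_atTop 0] with s hs using hC s hs x
  have hint := fun j (_ : j ∈ Finset.univ) =>
    integrableOn_rescale 2 (∂_{e j} (∂_{e j} (heatSchwartz 1))) ht x
  have hFTC := integral_Ioi_of_hasDerivAt_of_tendsto'
    (fun s hs => hasDerivAt_rescale_heatSchwartz (ht.trans_le hs) x)
    (integrable_finsetSum _ hint) hlim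
  rw [integral_finsetSum _ hint] at hFTC
  simp only [tail, hFTC]
  ring

theorem sum_lerayKernel_lineDeriv {t : ℝ} (ht : 0 < t) (l : Fin 3) (x : E3) :
    ∑ j, lerayKernel 1 (∂_{e j} (heatSchwartz 1)) j l t x = 0 := by
  set G := heatSchwartz 1
  have hpd : pd l (fun y => rescale 3 G t y + ∑ j, tail 5 (∂_{e j} (∂_{e j} G)) t y) x =
      rescale 4 (∂_{e l} G) t x + ∑ j, tail 6 (∂_{e l} (∂_{e j} (∂_{e j} G))) t x := by
    have htail := fun j => (contDiff_tail 2 (∂_{e j} (∂_{e j} G)) ht).differentiable one_ne_zero x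
    rw [pd, fderiv_fun_add ((contDiff_rescale 3 G t).differentiable one_ne_zero x)
      (.fun_sum fun j _ => htail j), fderiv_fun_sum fun j _ => htail j, add_apply, sum_apply]
    exact congrArg₂ _ (pd_rescale 3 G l t x)
      (Finset.sum_congr rfl fun j _ => pd_tail 2 _ l ht x)
  have hzero : pd l (fun y => rescale 3 G t y + ∑ j, tail 5 (∂_{e j} (∂_{e j} G)) t y) x = 0 := by
    rw [funext (rescale_heatSchwartz_add_sum_tail ht)]
    simp [pd]
  calc ∑ j, lerayKernel 1 (∂_{e j} G) j l t x
      = rescale 4 (∂_{e l} G) t x + ∑ j, tail 6 (∂_{e l} (∂_{e j} (∂_{e j} G))) t x := by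
        simp only [lerayKernel, Finset.sum_add_distrib, Finset.sum_ite_eq', Finset.mem_univ,
          if_true]
        simp only [lineDeriv_comm (e l)]
    _ = 0 := hpd.symm.trans hzero

theorem sum_pd_lerayKernel {t : ℝ} (ht : 0 < t) (l : Fin 3) (x : E3) :
    ∑ j, pd j (lerayKernel 0 (heatSchwartz 1) j l t) x = 0 := by
  simpa only [pd_lerayKernel 0 _ _ _ _ ht] using sum_lerayKernel_lineDeriv ht l x

theorem sum_pd_lerayKernel_lineDeriv {t : ℝ} (ht : 0 < t) (k l : Fin 3) (x : E3) :
    ∑ j, pd j (lerayKernel 1 (∂_{e k} (heatSchwartz 1)) j l t) x = 0 := by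
  set G := heatSchwartz 1
  calc ∑ j, pd j (lerayKernel 1 (∂_{e k} G) j l t) x
      = ∑ j, pd k (lerayKernel 1 (∂_{e j} G) j l t) x := by
        simp only [pd_lerayKernel 1 _ _ _ _ ht, lineDeriv_comm (e k)]
    _ = pd k (fun y => ∑ j, lerayKernel 1 (∂_{e j} G) j l t y) x := by
        rw [pd, fderiv_fun_sum fun j _ =>
          (contDiff_lerayKernel 1 (∂_{e j} G) j l ht).differentiable one_ne_zero x, sum_apply]
        rfl
    _ = 0 := by
        rw [funext (sum_lerayKernel_lineDeriv ht l)]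
        simp [pd]

/-! ### Divergence-free fields -/

theorem contDiff_pd {φ : E3 → ℝ} (hφ : ContDiff ℝ ∞ φ) (k : Fin 3) : ContDiff ℝ ∞ (pd k φ) :=
  (hφ.fderiv_right (m := ∞) (by simp)).clm_apply contDiff_const

theorem hasCompactSupport_pd {φ : E3 → ℝ} (hφ : HasCompactSupport φ) (k : Fin 3) :
    HasCompactSupport (pd k φ) :=
  hφ.fderiv_apply (𝕜 := ℝ) _

theorem toLp_eq_sum (a : Fin 3 → ℝ) : (WithLp.toLp 2 a : E3) = ∑ j, a j • e j := by
  ext i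
  simp [Pi.single_apply]

theorem fderiv_apply_toLp (φ : E3 → ℝ) (x : E3) (a : Fin 3 → ℝ) :
    fderiv ℝ φ x (WithLp.toLp 2 a) = ∑ j, pd j φ x * a j := by
  simp only [toLp_eq_sum, map_sum, map_smul, smul_eq_mul, pd, mul_comm]

theorem integral_pd_mul {φ f : E3 → ℝ} (hφ : ContDiff ℝ ∞ φ) (hc : HasCompactSupport φ)
    (hf : ContDiff ℝ 1 f) (k : Fin 3) : ∫ x, pd k φ x * f x = -∫ x, φ x * pd k f x := by
  have hpd : Continuous (pd k f) := (hf.continuous_fderiv one_ne_zero).clm_apply continuous_const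
  refine (neg_eq_iff_eq_neg.1 (integral_mul_fderiv_eq_neg_fderiv_mul_of_integrable (𝕜 := ℝ)
    (μ := volume) (f := φ) (g := f) (v := e k)
    (((contDiff_pd hφ k).continuous.mul hf.continuous).integrable_of_hasCompactSupport
      (hasCompactSupport_pd hc k).mul_right)
    ((hφ.continuous.mul hpd).integrable_of_hasCompactSupport hc.mul_right)
    ((hφ.continuous.mul hf.continuous).integrable_of_hasCompactSupport hc.mul_right)
    (fun x _ => hφ.differentiable (by simp) x)
    (fun x _ => hf.differentiable one_ne_zero x)).symm)

theorem isDivFree_of_sum_pd_eq_zero {f : Fin 3 → E3 → ℝ} (hf : ∀ j, ContDiff ℝ 1 (f j))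
    (hdiv : ∀ x, ∑ j, pd j (f j) x = 0) : IsDivFree fun x => WithLp.toLp 2 fun j => f j x := by
  intro φ hφ hc
  have hpd (j) : Continuous (pd j (f j)) :=
    ((hf j).continuous_fderiv one_ne_zero).clm_apply continuous_const
  calc ∫ x, fderiv ℝ φ x (WithLp.toLp 2 fun j => f j x)
      = ∑ j, ∫ x, pd j φ x * f j x := by
        simp only [fderiv_apply_toLp]
        exact integral_finsetSum _ fun j _ => ((contDiff_pd hφ j).continuous.mul
          (hf j).continuous).integrable_of_hasCompactSupport (hasCompactSupport_pd hc j).mul_right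
    _ = -∑ j, ∫ x, φ x * pd j (f j) x := by
        rw [← Finset.sum_neg_distrib]
        exact Finset.sum_congr rfl fun j _ => integral_pd_mul hφ hc (hf j) j
    _ = -∫ x, φ x * ∑ j, pd j (f j) x := by
        have hint (j) : Integrable fun x => φ x * pd j (f j) x :=
          (hφ.continuous.mul (hpd j)).integrable_of_hasCompactSupport hc.mul_right
        simp only [Finset.mul_sum]
        rw [integral_finsetSum _ fun j _ => hint j]
    _ = 0 := by simp [hdiv]

theorem IsDivFree.const_smul {v : E3 → E3} (hv : IsDivFree v) (a : ℝ) :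
    IsDivFree fun x => a • v x := fun φ hφ hc => by
  simp only [map_smul, integral_smul, hv φ hφ hc, smul_zero]

theorem IsDivFree.comp_sub_right {v : E3 → E3} (hv : IsDivFree v) (y : E3) :
    IsDivFree fun x => v (x - y) := by
  intro φ hφ hc
  have h := hv (fun x => φ (x + y)) (hφ.comp (contDiff_id.add contDiff_const))
    (hc.comp_homeomorph (Homeomorph.addRight y))
  simp only [fderiv_comp_add_right] at h
  rw [← h, ← integral_sub_right_eq_self (fun x => fderiv ℝ φ (x + y) (v x)) y]
  simp only [sub_add_cancel]

/-- Bounded measurable fields that are divergence-free in the sense of distributions. -/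
structure BoundedSolenoidal (v : E3 → E3) : Prop where
  meas : AEStronglyMeasurable v volume
  bounded : ∃ C, ∀ x, ‖v x‖ ≤ C
  divFree : IsDivFree v

namespace BoundedSolenoidal

variable {v w : E3 → E3}

theorem integrable_fderiv_apply (hv : BoundedSolenoidal v) {φ : E3 → ℝ} (hφ : ContDiff ℝ ∞ φ)
    (hc : HasCompactSupport φ) : Integrable fun x => fderiv ℝ φ x (v x) := by
  obtain ⟨C, hC⟩ := hv.bounded
  have hDφ : Continuous (fderiv ℝ φ) := hφ.continuous_fderiv (by simp)
  refine ((hDφ.integrable_of_hasCompactSupport (hc.fderiv (𝕜 := ℝ))).norm.mul_const C).mono'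
    ((ContinuousLinearMap.id ℝ (E3 →L[ℝ] ℝ)).aestronglyMeasurable_comp₂
      hDφ.aestronglyMeasurable hv.meas) (.of_forall fun x => ?_)
  exact (ContinuousLinearMap.le_opNorm _ _).trans (by gcongr; exact hC x)

protected theorem zero : BoundedSolenoidal fun _ => 0 :=
  ⟨aestronglyMeasurable_const, ⟨0, by simp⟩, fun φ _ _ => by simp⟩

protected theorem add (hv : BoundedSolenoidal v) (hw : BoundedSolenoidal w) :
    BoundedSolenoidal fun x => v x + w x := by
  obtain ⟨C, hC⟩ := hv.bounded
  obtain ⟨D, hD⟩ := hw.bounded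
  refine ⟨hv.meas.add hw.meas, ⟨C + D, fun x => norm_add_le_of_le (hC x) (hD x)⟩,
    fun φ hφ hc => ?_⟩
  simp only [map_add]
  rw [integral_add (hv.integrable_fderiv_apply hφ hc) (hw.integrable_fderiv_apply hφ hc),
    hv.divFree φ hφ hc, hw.divFree φ hφ hc, add_zero]

protected theorem smul (hv : BoundedSolenoidal v) (a : ℝ) :
    BoundedSolenoidal fun x => a • v x := by
  obtain ⟨C, hC⟩ := hv.bounded
  refine ⟨hv.meas.const_smul a, ⟨|a| * C, fun x => ?_⟩, fun φ hφ hc => ?_⟩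
  · rw [norm_smul, Real.norm_eq_abs]
    gcongr
    exact hC x
  · exact hv.divFree.const_smul a φ hφ hc

protected theorem sum {ι : Type*} (s : Finset ι) {v : ι → E3 → E3}
    (hv : ∀ i, BoundedSolenoidal (v i)) : BoundedSolenoidal fun x => ∑ i ∈ s, v i x := by
  classical
  induction s using Finset.induction_on with
  | empty => simpa using BoundedSolenoidal.zero
  | insert i s hi ih => simpa only [Finset.sum_insert hi] using (hv i).add ih

protected theorem integral {Q : Type*} [MeasurableSpace Q] {μ : Measure Q} [SFinite μ]
    {w : Q → E3 → E3} {C : ℝ}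
    (hm : AEStronglyMeasurable (fun p : E3 × Q => w p.2 p.1) (volume.prod μ))
    (hint : ∀ x, Integrable (fun q => w q x) μ) (hC : ∀ x, ∫ q, ‖w q x‖ ∂μ ≤ C)
    (hdiv : ∀ᵐ q ∂μ, IsDivFree (w q)) : BoundedSolenoidal fun x => ∫ q, w q x ∂μ := by
  refine ⟨hm.integral_prod_right', ⟨C, fun x => (norm_integral_le_integral_norm _).trans (hC x)⟩,
    fun φ hφ hc => ?_⟩
  have hDφ : Continuous (fderiv ℝ φ) := hφ.continuous_fderiv (by simp)
  have hDφi := (hDφ.integrable_of_hasCompactSupport (hc.fderiv (𝕜 := ℝ)) (μ := volume)).norm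
  have hle (x q) : ‖fderiv ℝ φ x (w q x)‖ ≤ ‖fderiv ℝ φ x‖ * ‖w q x‖ :=
    ContinuousLinearMap.le_opNorm _ _
  have hprod : Integrable (Function.uncurry fun x q => fderiv ℝ φ x (w q x))
      (volume.prod μ) := by
    have hmeas : AEStronglyMeasurable (Function.uncurry fun x q => fderiv ℝ φ x (w q x))
        (volume.prod μ) :=
      (ContinuousLinearMap.id ℝ (E3 →L[ℝ] ℝ)).aestronglyMeasurable_comp₂
        hDφ.aestronglyMeasurable.comp_fst hm
    refine (integrable_prod_iff hmeas).2 ⟨.of_forall fun x =>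
      (fderiv ℝ φ x).integrable_comp (hint x), ?_⟩
    refine (hDφi.mul_const C).mono' hmeas.norm.integral_prod_right' (.of_forall fun x => ?_)
    rw [Real.norm_of_nonneg (integral_nonneg fun q => norm_nonneg _)]
    calc ∫ q, ‖fderiv ℝ φ x (w q x)‖ ∂μ
        ≤ ∫ q, ‖fderiv ℝ φ x‖ * ‖w q x‖ ∂μ := integral_mono_of_nonneg
          (.of_forall fun q => norm_nonneg _) ((hint x).norm.const_mul _) (.of_forall (hle x))
      _ ≤ ‖fderiv ℝ φ x‖ * C := by
          rw [integral_const_mul]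
          gcongr
          exact hC x
  calc ∫ x, fderiv ℝ φ x (∫ q, w q x ∂μ)
      = ∫ x, ∫ q, fderiv ℝ φ x (w q x) ∂μ :=
        integral_congr_ae (.of_forall fun x =>
          ((fderiv ℝ φ x).integral_comp_comm (hint x)).symm)
    _ = ∫ q, (∫ x, fderiv ℝ φ x (w q x)) ∂μ := integral_integral_swap hprod
    _ = 0 := integral_eq_zero_of_ae (hdiv.mono fun q hq => hq φ hφ hc)

end BoundedSolenoidal

theorem norm_toLp_le {f : Fin 3 → ℝ} {C : ℝ} (hf : ∀ j, |f j| ≤ C) :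
    ‖(WithLp.toLp 2 f : E3)‖ ≤ 3 * C := by
  rw [toLp_eq_sum]
  refine (norm_sum_le_of_le _ fun j _ => ?_).trans_eq (by simp : ∑ _j : Fin 3, C = 3 * C)
  simpa [norm_smul] using hf j

/-- The `l`-th column of the matrix kernel `lerayKernel m g`. -/
def lerayColumn (m : ℕ) (g : 𝓢(E3, ℝ)) (l : Fin 3) (t : ℝ) (x : E3) : E3 :=
  WithLp.toLp 2 fun j => lerayKernel m g j l t x

theorem measurable_lerayColumn (m : ℕ) (g : 𝓢(E3, ℝ)) (l : Fin 3) :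
    Measurable fun p : ℝ × E3 => lerayColumn m g l p.1 p.2 :=
  (PiLp.continuous_toLp 2 fun _ : Fin 3 => ℝ).measurable.comp
    (measurable_pi_lambda _ fun j => measurable_lerayKernel m g j l)

theorem exists_parabolicDecay_lerayColumn (m : ℕ) (g : 𝓢(E3, ℝ)) (l : Fin 3) :
    ∃ C, 0 ≤ C ∧ ParabolicDecay (lerayColumn m g l) (m + 3) C := by
  choose C hC0 hC using fun j => exists_parabolicDecay_lerayKernel m g j l
  have hsum (j) : C j ≤ ∑ i, C i := Finset.single_le_sum (fun i _ => hC0 i) (Finset.mem_univ j)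
  have hnonneg : 0 ≤ ∑ i, C i := Finset.sum_nonneg fun i _ => hC0 i
  refine ⟨3 * ∑ i, C i, by positivity, fun t ht x => ?_⟩
  rw [mul_assoc]
  exact norm_toLp_le fun j => (hC j).mono (hsum j) t ht x

theorem isDivFree_oseenColumn (l : Fin 3) {t : ℝ} (ht : 0 < t) :
    IsDivFree (lerayColumn 0 (heatSchwartz 1) l t) :=
  isDivFree_of_sum_pd_eq_zero (fun j => contDiff_lerayKernel 0 _ j l ht) (sum_pd_lerayKernel ht l)

theorem isDivFree_oseenColumn_lineDeriv (k l : Fin 3) {t : ℝ} (ht : 0 < t) :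
    IsDivFree (lerayColumn 1 (∂_{e k} (heatSchwartz 1)) l t) :=
  isDivFree_of_sum_pd_eq_zero (fun j => contDiff_lerayKernel 1 _ j l ht)
    (sum_pd_lerayKernel_lineDeriv ht k l)

section SchwartzDilation

variable {V F : Type*} [NormedAddCommGroup V] [NormedSpace ℝ V] [NormedAddCommGroup F]
  [NormedSpace ℝ F]

theorem exists_one_add_norm_pow_mul_iteratedFDeriv_le (g : 𝓢(V, F)) (p n : ℕ) :
    ∃ C, 0 ≤ C ∧ ∀ x, (1 + ‖x‖) ^ p * ‖iteratedFDeriv ℝ n g x‖ ≤ C :=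
  ⟨_, by positivity, SchwartzMap.one_add_le_sup_seminorm_apply (𝕜 := ℝ) (m := (p, n)) le_rfl
    le_rfl g⟩

theorem pow_mul_norm_iteratedFDeriv_sub_le (g : 𝓢(V, F)) {p n : ℕ} {C R ρ : ℝ}
    (hg : ∀ x, (1 + ‖x‖) ^ p * ‖iteratedFDeriv ℝ (n + 1) g x‖ ≤ C) (hR : 0 ≤ R) (hρ : 0 < ρ)
    {x y : V} (hxy : ∀ z, ‖z - x‖ ≤ ‖y - x‖ → ρ ≤ R * (1 + ‖z‖)) :
    ρ ^ p * ‖iteratedFDeriv ℝ n g y - iteratedFDeriv ℝ n g x‖ ≤ R ^ p * C * ‖y - x‖ := by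
  have hmv : ‖iteratedFDeriv ℝ n g y - iteratedFDeriv ℝ n g x‖
      ≤ R ^ p * C / ρ ^ p * ‖y - x‖ := by
    refine (convex_closedBall x ‖y - x‖).norm_image_sub_le_of_norm_fderiv_le (𝕜 := ℝ)
      (fun z _ => (g.smooth (n + 1 : ℕ)).differentiable_iteratedFDeriv
        (by exact_mod_cast n.lt_succ_self) z) (fun z hz => ?_)
      (Metric.mem_closedBall_self (norm_nonneg _)) (by simp [dist_eq_norm])
    rw [norm_fderiv_iteratedFDeriv, le_div_iff₀ (pow_pos hρ p)]
    calc ‖iteratedFDeriv ℝ (n + 1) g z‖ * ρ ^ p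
        ≤ ‖iteratedFDeriv ℝ (n + 1) g z‖ * (R * (1 + ‖z‖)) ^ p := by
          gcongr
          exact hxy z (by simpa [dist_eq_norm] using hz)
      _ = R ^ p * ((1 + ‖z‖) ^ p * ‖iteratedFDeriv ℝ (n + 1) g z‖) := by rw [mul_pow]; ring
      _ ≤ R ^ p * C := by gcongr; exact hg z
  calc _ ≤ ρ ^ p * (R ^ p * C / ρ ^ p * ‖y - x‖) := by gcongr
    _ = _ := by field_simp

theorem one_add_norm_le_of_norm_sub_affine_le {a : ℝ} (ha : 0 < a) {b y z : V}
    (hz : ‖z - (a • y + b)‖ ≤ a / 2 * ‖y‖ + 1) :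
    1 + ‖y‖ ≤ (1 + 2 / a * (‖b‖ + 1)) * (1 + ‖z‖) := by
  have htri : a * ‖y‖ ≤ ‖z‖ + ‖z - (a • y + b)‖ + ‖b‖ := by
    calc a * ‖y‖ = ‖z - (z - (a • y + b)) - b‖ := by
          rw [← Real.norm_of_nonneg ha.le, ← norm_smul, Real.norm_of_nonneg ha.le]
          congr 1
          abel
      _ ≤ _ := (norm_sub_le _ _).trans (by gcongr; exact norm_sub_le _ _)
  have hy : ‖y‖ ≤ 2 / a * (‖z‖ + ‖b‖ + 1) := by
    rw [div_mul_eq_mul_div, le_div_iff₀ ha]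
    linarith
  have hprod : ‖z‖ + ‖b‖ + 1 ≤ (‖b‖ + 1) * (1 + ‖z‖) := by
    nlinarith [mul_nonneg (norm_nonneg b) (norm_nonneg z)]
  calc 1 + ‖y‖ ≤ 1 + 2 / a * ((‖b‖ + 1) * (1 + ‖z‖)) := by gcongr; exact hy.trans (by gcongr)
    _ ≤ _ := by linarith [norm_nonneg z]

theorem exists_iteratedFDeriv_comp_affine_le (g : 𝓢(V, F)) {a₀ : ℝ} (ha₀ : 0 < a₀) (b₀ : V)
    (p n : ℕ) :
    ∃ A ≥ 0, ∃ B ≥ 0, ∀ a b, |a - a₀| ≤ a₀ / 2 → ‖b - b₀‖ ≤ 1 → ∀ y,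
      (1 + ‖y‖) ^ p * ‖iteratedFDeriv ℝ n g (a • y + b)‖ ≤ A ∧
      (1 + ‖y‖) ^ p * ‖iteratedFDeriv ℝ n g (a • y + b) - iteratedFDeriv ℝ n g (a₀ • y + b₀)‖
        ≤ B * (|a - a₀| + ‖b - b₀‖) := by
  obtain ⟨C, hC0, hC⟩ := exists_one_add_norm_pow_mul_iteratedFDeriv_le g p n
  obtain ⟨D, hD0, hD⟩ := exists_one_add_norm_pow_mul_iteratedFDeriv_le g (p + 1) (n + 1)
  set R := 1 + 2 / a₀ * (‖b₀‖ + 1)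
  have hR : 0 ≤ R := by positivity
  refine ⟨R ^ p * C, by positivity, R ^ (p + 1) * D, by positivity, fun a b ha hb y => ?_⟩
  have hdist : ‖(a • y + b) - (a₀ • y + b₀)‖ ≤ |a - a₀| * ‖y‖ + ‖b - b₀‖ := by
    rw [add_sub_add_comm, ← sub_smul]
    exact (norm_add_le _ _).trans_eq (by rw [norm_smul, Real.norm_eq_abs])
  have hcomp (z) (hz : ‖z - (a₀ • y + b₀)‖ ≤ ‖(a • y + b) - (a₀ • y + b₀)‖) :
      1 + ‖y‖ ≤ R * (1 + ‖z‖) :=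
    one_add_norm_le_of_norm_sub_affine_le ha₀ (hz.trans (hdist.trans (by gcongr)))
  constructor
  · calc _ ≤ (R * (1 + ‖a • y + b‖)) ^ p * ‖iteratedFDeriv ℝ n g (a • y + b)‖ := by
          gcongr
          exact hcomp _ le_rfl
      _ = R ^ p * ((1 + ‖a • y + b‖) ^ p * ‖iteratedFDeriv ℝ n g (a • y + b)‖) := by
          rw [mul_pow]; ring
      _ ≤ R ^ p * C := by gcongr; exact hC _
  · have hle : ‖(a • y + b) - (a₀ • y + b₀)‖ ≤ (1 + ‖y‖) * (|a - a₀| + ‖b - b₀‖) :=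
      hdist.trans (by nlinarith [norm_nonneg y, norm_nonneg (b - b₀), abs_nonneg (a - a₀)])
    refine le_of_mul_le_mul_left ?_ (by positivity : 0 < 1 + ‖y‖)
    calc _ = (1 + ‖y‖) ^ (p + 1) *
          ‖iteratedFDeriv ℝ n g (a • y + b) - iteratedFDeriv ℝ n g (a₀ • y + b₀)‖ := by ring
      _ ≤ R ^ (p + 1) * D * ‖(a • y + b) - (a₀ • y + b₀)‖ :=
        pow_mul_norm_iteratedFDeriv_sub_le g hD hR (by positivity) hcomp
      _ ≤ R ^ (p + 1) * D * ((1 + ‖y‖) * (|a - a₀| + ‖b - b₀‖)) := by gcongr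
      _ = _ := by ring

theorem exists_iteratedFDeriv_comp_affine_sub_le (g : 𝓢(V, F)) {a₀ : ℝ} (ha₀ : 0 < a₀) (b₀ : V)
    (p n : ℕ) :
    ∃ C, ∀ a b, |a - a₀| ≤ a₀ / 2 → ‖b - b₀‖ ≤ 1 → ∀ y,
      ‖y‖ ^ p * ‖a ^ n • iteratedFDeriv ℝ n g (a • y + b)
        - a₀ ^ n • iteratedFDeriv ℝ n g (a₀ • y + b₀)‖
      ≤ C * (|a ^ n - a₀ ^ n| + (|a - a₀| + ‖b - b₀‖)) := by
  obtain ⟨A, hA0, B, hB0, hAB⟩ := exists_iteratedFDeriv_comp_affine_le g ha₀ b₀ p n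
  refine ⟨A + a₀ ^ n * B, fun a b ha hb y => ?_⟩
  obtain ⟨hA, hB⟩ := hAB a b ha hb y
  have hsplit : a ^ n • iteratedFDeriv ℝ n g (a • y + b)
        - a₀ ^ n • iteratedFDeriv ℝ n g (a₀ • y + b₀)
      = (a ^ n - a₀ ^ n) • iteratedFDeriv ℝ n g (a • y + b) + a₀ ^ n •
        (iteratedFDeriv ℝ n g (a • y + b) - iteratedFDeriv ℝ n g (a₀ • y + b₀)) := by
    module
  rw [hsplit]
  calc _ ≤ (1 + ‖y‖) ^ p * (|a ^ n - a₀ ^ n| * ‖iteratedFDeriv ℝ n g (a • y + b)‖ + a₀ ^ n *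
        ‖iteratedFDeriv ℝ n g (a • y + b) - iteratedFDeriv ℝ n g (a₀ • y + b₀)‖) := by
        gcongr
        · linarith
        · refine (norm_add_le _ _).trans_eq ?_
          rw [norm_smul, norm_smul, Real.norm_eq_abs, Real.norm_of_nonneg (by positivity)]
    _ = |a ^ n - a₀ ^ n| * ((1 + ‖y‖) ^ p * ‖iteratedFDeriv ℝ n g (a • y + b)‖) + a₀ ^ n *
        ((1 + ‖y‖) ^ p *
          ‖iteratedFDeriv ℝ n g (a • y + b) - iteratedFDeriv ℝ n g (a₀ • y + b₀)‖) := by ring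
    _ ≤ |a ^ n - a₀ ^ n| * A + a₀ ^ n * (B * (|a - a₀| + ‖b - b₀‖)) := by gcongr
    _ ≤ _ := by
        have hcross : 0 ≤ |a ^ n - a₀ ^ n| * (a₀ ^ n * B) := by positivity
        have hcross' : 0 ≤ (|a - a₀| + ‖b - b₀‖) * A := by positivity
        linarith

theorem tendsto_of_eventually_eq_comp_affine (g : 𝓢(V, F)) {ι : Type*} {l : Filter ι}
    {u : ι → 𝓢(V, F)} {f : 𝓢(V, F)} {a : ι → ℝ} {b : ι → V} {a₀ : ℝ} {b₀ : V} (ha₀ : 0 < a₀)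
    (ha : Tendsto a l (𝓝 a₀)) (hb : Tendsto b l (𝓝 b₀))
    (hu : ∀ᶠ i in l, ∀ y, u i y = g (a i • y + b i)) (hf : ∀ y, f y = g (a₀ • y + b₀)) :
    Tendsto u l (𝓝 f) := by
  rw [(schwartz_withSeminorms ℝ V F).tendsto_nhds]
  rintro ⟨p, n⟩ ε hε
  obtain ⟨C, hC⟩ := exists_iteratedFDeriv_comp_affine_sub_le g ha₀ b₀ p n
  have hderiv {h : 𝓢(V, F)} {c : ℝ} {d : V} (hh : ∀ y, h y = g (c • y + d)) (y : V) :
      iteratedFDeriv ℝ n h y = c ^ n • iteratedFDeriv ℝ n g (c • y + d) := by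
    have hsmooth : ContDiff ℝ n fun z => g (z + d) :=
      (g.smooth n).comp (contDiff_id.add contDiff_const)
    rw [show (h : V → F) = fun y => (fun z => g (z + d)) (c • y) from funext hh,
      congrFun (iteratedFDeriv_comp_const_smul c hsmooth) y, iteratedFDeriv_comp_add_right]
  have hlim : Tendsto (fun i => C * (|a i ^ n - a₀ ^ n| + (|a i - a₀| + ‖b i - b₀‖))) l (𝓝 0) := by
    have hpow := ((ha.pow n).sub_const (a₀ ^ n)).abs
    have := (hpow.add ((ha.sub_const a₀).abs.add (hb.sub_const b₀).norm)).const_mul C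
    simpa using this
  have ha' : ∀ᶠ i in l, |a i - a₀| ≤ a₀ / 2 := by
    simpa [Real.dist_eq] using ha.eventually (Metric.closedBall_mem_nhds a₀ (half_pos ha₀))
  have hb' : ∀ᶠ i in l, ‖b i - b₀‖ ≤ 1 := by
    simpa [dist_eq_norm] using hb.eventually (Metric.closedBall_mem_nhds b₀ one_pos)
  filter_upwards [hlim.eventually_lt_const hε, ha', hb', hu] with i hlt hai hbi hui
  refine (SchwartzMap.seminorm_le_bound ℝ p n _ ?_ fun y => ?_).trans_lt hlt
  · exact le_trans (by positivity) (hC (a i) (b i) hai hbi 0)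
  · rw [show ((u i - f : 𝓢(V, F)) : V → F) = u i - f from rfl,
      iteratedFDeriv_sub_apply ((u i).smooth n).contDiffAt (f.smooth n).contDiffAt, hderiv hui,
      hderiv hf]
    exact hC (a i) (b i) hai hbi y

end SchwartzDilation

theorem continuousOn_heatFlowDistr (θ₀ : RealTempered) :
    ContinuousOn (fun p : ℝ × E3 => heatFlowDistr θ₀ p.1 p.2) (Ioi 0 ×ˢ univ) := by
  rintro ⟨t, x⟩ ⟨ht, -⟩
  replace ht : 0 < t := ht
  have hscale {s : ℝ} (hs : 0 < s) (z y : E3) :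
      (√s ^ 3 • SchwartzMap.compSubConstCLM ℝ z (heatSchwartz s)) y
        = heatSchwartz 1 ((√s)⁻¹ • y + -((√s)⁻¹ • z)) := by
    have hs' : √s ≠ 0 := (Real.sqrt_pos.2 hs).ne'
    simp [heatSchwartz_apply hs, heatKernel_eq_rescale hs, rescale, hs', sub_eq_add_neg]
  have hsqrt : ContinuousAt (fun p : ℝ × E3 => √p.1) (t, x) := by fun_prop
  have hinv : ContinuousAt (fun p : ℝ × E3 => (√p.1)⁻¹) (t, x) :=
    hsqrt.inv₀ (Real.sqrt_pos.2 ht).ne'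
  have hpos : ∀ᶠ p : ℝ × E3 in 𝓝 (t, x), 0 < p.1 := continuousAt_fst.eventually_const_lt ht
  have hlim : Tendsto (fun p : ℝ × E3 => √p.1 ^ 3 • SchwartzMap.compSubConstCLM ℝ p.2
      (heatSchwartz p.1)) (𝓝 (t, x)) (𝓝 (√t ^ 3 • SchwartzMap.compSubConstCLM ℝ x
      (heatSchwartz t))) :=
    tendsto_of_eventually_eq_comp_affine (heatSchwartz 1) (inv_pos.2 (Real.sqrt_pos.2 ht)) hinv
      (hinv.smul continuousAt_snd).neg (hpos.mono fun p hp => hscale hp p.2) (hscale ht x)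
  have hpair := (hinv.pow 3).mul ((θ₀.continuous.tendsto _).comp hlim)
  refine (ContinuousAt.congr hpair (hpos.mono fun p hp => ?_)).continuousWithinAt
  have hp' : √p.1 ≠ 0 := (Real.sqrt_pos.2 hp).ne'
  simp [heatFlowDistr, hp']

theorem measurable_heatFlowDistr (θ₀ : RealTempered) :
    Measurable fun p : ℝ × E3 => heatFlowDistr θ₀ p.1 p.2 := by
  classical
  refine (congrArg Measurable (funext fun p => ?_)).mpr
    ((continuousOn_heatFlowDistr θ₀).measurable_piecewise (continuousOn_const (c := 0))
      (measurableSet_Ioi.prod MeasurableSet.univ))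
  by_cases hp : p ∈ Ioi (0 : ℝ) ×ˢ (univ : Set E3)
  · rw [piecewise_eq_of_mem _ _ _ hp]
  · rw [piecewise_eq_of_notMem _ _ _ hp, heatFlowDistr, heatSchwartz,
      dif_neg (show ¬0 < p.1 from fun h => hp ⟨h, mem_univ _⟩), map_zero, map_zero]

/-! ### Duhamel integrals -/

theorem inv_pow_mul_inv_pow_le {A B R : ℝ} {p n : ℕ} (hA : 0 < A) (hB : 0 < B) (hR : 0 < R)
    (h : R ≤ A + B) (hp : p ≤ n) :
    (A ^ n)⁻¹ * (B ^ p)⁻¹ ≤ 2 ^ n * (R ^ p)⁻¹ * ((A ^ n)⁻¹ + (B ^ n)⁻¹) := by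
  have hhalf {m : ℝ} (hm : R / 2 ≤ m) : (m ^ p)⁻¹ ≤ 2 ^ n * (R ^ p)⁻¹ := by
    calc (m ^ p)⁻¹ ≤ ((R / 2) ^ p)⁻¹ := by gcongr
      _ = 2 ^ p * (R ^ p)⁻¹ := by rw [div_pow, inv_div, div_eq_mul_inv]
      _ ≤ 2 ^ n * (R ^ p)⁻¹ := by gcongr; norm_num
  rcases le_total A B with hAB | hAB
  · calc (A ^ n)⁻¹ * (B ^ p)⁻¹ ≤ (A ^ n)⁻¹ * (2 ^ n * (R ^ p)⁻¹) := by
          gcongr; exact hhalf (by linarith)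
      _ = 2 ^ n * (R ^ p)⁻¹ * (A ^ n)⁻¹ := mul_comm _ _
      _ ≤ _ := by gcongr; exact le_add_of_nonneg_right (by positivity)
  · have hsplit (m : ℝ) : (m ^ n)⁻¹ = (m ^ p)⁻¹ * (m ^ (n - p))⁻¹ := by
      rw [← mul_inv, ← pow_add, Nat.add_sub_cancel' hp]
    calc (A ^ n)⁻¹ * (B ^ p)⁻¹ = (A ^ p)⁻¹ * (A ^ (n - p))⁻¹ * (B ^ p)⁻¹ := by rw [hsplit A]
      _ ≤ 2 ^ n * (R ^ p)⁻¹ * (B ^ (n - p))⁻¹ * (B ^ p)⁻¹ := by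
          gcongr; exact hhalf (by linarith)
      _ = 2 ^ n * (R ^ p)⁻¹ * (B ^ n)⁻¹ := by rw [hsplit B]; ring
      _ ≤ _ := by gcongr; exact le_add_of_nonneg_left (by positivity)

theorem integrableOn_inv_sqrt (t : ℝ) : IntegrableOn (fun s => (√s)⁻¹) (Ioo 0 t) := by
  have hpow : IntegrableOn (fun s : ℝ => s ^ (-(1 / 2) : ℝ)) (Ioo 0 t) :=
    (intervalIntegral.intervalIntegrable_rpow' (a := 0) (b := t) (by norm_num)).1.mono_set
      Ioo_subset_Ioc_self
  exact hpow.congr_fun (fun s hs => by simp [Real.sqrt_eq_rpow, ← Real.rpow_neg hs.1.le])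
    measurableSet_Ioo

theorem integral_inv_sqrt {t : ℝ} (ht : 0 ≤ t) : ∫ s in Ioo 0 t, (√s)⁻¹ = 2 * √t := by
  have hpow : EqOn (fun s => (√s)⁻¹) (fun s => s ^ (-(1 / 2) : ℝ)) (Ioo 0 t) :=
    fun s hs => by simp [Real.sqrt_eq_rpow, ← Real.rpow_neg hs.1.le]
  rw [setIntegral_congr_fun measurableSet_Ioo hpow, ← integral_Ioc_eq_integral_Ioo,
    ← intervalIntegral.integral_of_le ht, integral_rpow (.inl (by norm_num)), Real.sqrt_eq_rpow]
  norm_num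
  ring

section SpaceTime

variable {V : Type*} [MeasureSpace V]

variable (V) in
/-- Lebesgue measure on `(0,∞) × V`. -/
abbrev spaceTime : Measure (ℝ × V) := volume.restrict (Ioi 0 ×ˢ univ)

variable (V) in
/-- Lebesgue measure on `(0,t) × V`. -/
def slab (t : ℝ) : Measure (ℝ × V) := (volume.restrict (Ioo 0 t)).prod volume

theorem ae_slab_mem_Ioo (t : ℝ) : ∀ᵐ q ∂slab V t, q.1 ∈ Ioo 0 t :=
  Measure.quasiMeasurePreserving_fst.ae (ae_restrict_mem measurableSet_Ioo)

variable [SFinite (volume : Measure V)]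

instance (t : ℝ) : SFinite (slab V t) := by unfold slab; infer_instance

theorem slab_eq_restrict (t : ℝ) : slab V t = (spaceTime V).restrict {q | q.1 < t} := by
  have hset : {q : ℝ × V | q.1 < t} ∩ Ioi (0 : ℝ) ×ˢ univ = Ioo 0 t ×ˢ univ := by
    ext q
    simp [and_comm]
  rw [Measure.restrict_restrict (measurableSet_lt measurable_fst measurable_const), hset, slab,
    Measure.volume_eq_prod, ← Measure.prod_restrict, Measure.restrict_univ]

theorem slab_le_spaceTime (t : ℝ) : slab V t ≤ spaceTime V :=
  slab_eq_restrict (V := V) t ▸ Measure.restrict_le_self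

end SpaceTime

section Duhamel

open Module (finrank)

variable {V E : Type*} [NormedAddCommGroup V] [NormedAddCommGroup E]

theorem parabolic_triangle {s t : ℝ} (hs : 0 ≤ s)
    (hst : s ≤ t) (x y : V) : √t + ‖x‖ ≤ (√(t - s) + ‖x - y‖) + (√s + ‖y‖) := by
  have htime : √t ≤ √(t - s) + √s := by
    refine Real.sqrt_le_iff.2 ⟨by positivity, ?_⟩
    nlinarith [Real.sq_sqrt hs, Real.sq_sqrt (sub_nonneg.2 hst),
      mul_nonneg (Real.sqrt_nonneg (t - s)) (Real.sqrt_nonneg s)]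
  have hspace : ‖x‖ ≤ ‖x - y‖ + ‖y‖ := by
    simpa using norm_add_le (x - y) y
  linarith

variable [NormedSpace ℝ V]

theorem inv_add_norm_pow_scaling {σ : ℝ} (hσ : 0 < σ) (n : ℕ) (x : V) :
    ((σ + ‖x‖) ^ n)⁻¹ = (σ ^ n)⁻¹ * ((1 + ‖σ⁻¹ • x‖) ^ n)⁻¹ := by
  rw [norm_smul, Real.norm_of_nonneg (by positivity), ← mul_inv, ← mul_pow]
  congr 2
  field_simp

variable [MeasureSpace V]

variable (V) in
/-- The constant `∫ (1 + |x|)^(-(d+1)) dx`, `d = dim V`. -/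
def weightIntegral : ℝ := ∫ x : V, ((1 + ‖x‖) ^ (finrank ℝ V + 1))⁻¹

variable (V) in
/-- The constant in `norm_duhamel_le`. -/
def duhamelConst : ℝ := 2 ^ (finrank ℝ V + 3) * weightIntegral V

theorem duhamelConst_nonneg : 0 ≤ duhamelConst V :=
  mul_nonneg (by positivity) (integral_nonneg fun x => by positivity)

/-- `K(τ,z)` has the size `c (√τ + |z|)^(-(d+1))` of a first derivative of the heat kernel in
dimension `d`, at times `0 < τ < t`; the constant may depend on `t`. -/
structure DuhamelKernel (K : ℝ → V → E) (t c : ℝ) : Prop where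
  meas : StronglyMeasurable (Function.uncurry K)
  bound : ∀ τ ∈ Ioo 0 t, ∀ z, ‖K τ z‖ ≤ c * ((√τ + ‖z‖) ^ (finrank ℝ V + 1))⁻¹

/-- A measurable source of size `D (√s + |y|)⁻ᵖ`, with `p ≤ d + 1`. -/
structure DuhamelSource (F : ℝ → V → ℝ) (p : ℕ) (D : ℝ) : Prop where
  meas : AEStronglyMeasurable (Function.uncurry F) (spaceTime V)
  decay : ParabolicDecay F p D
  exponent_le : p ≤ finrank ℝ V + 1

theorem DuhamelKernel.const_nonneg {K : ℝ → V → E} {t c : ℝ} (hK : DuhamelKernel K t c)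
    (ht : 0 < t) : 0 ≤ c := by
  have := Real.sqrt_pos.2 (half_pos ht)
  exact nonneg_of_mul_nonneg_left ((norm_nonneg _).trans
    (hK.bound (t / 2) ⟨half_pos ht, half_lt_self ht⟩ 0)) (by positivity)

theorem DuhamelSource.sub {F G : ℝ → V → ℝ} {p : ℕ} {C D : ℝ} (hF : DuhamelSource F p C)
    (hG : DuhamelSource G p D) : DuhamelSource (fun s y => F s y - G s y) p (C + D) where
  meas := hF.meas.sub hG.meas
  decay := hF.decay.sub hG.decay
  exponent_le := hF.exponent_le

theorem ParabolicDecay.duhamelKernel {K : ℝ → V → E} {c : ℝ}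
    (hK : ParabolicDecay K (finrank ℝ V + 1) c) (hm : StronglyMeasurable (Function.uncurry K))
    (t : ℝ) : DuhamelKernel K t c where
  meas := hm
  bound := fun τ hτ => hK τ hτ.1

section

variable [NormedSpace ℝ E]

theorem DuhamelKernel.time_smul {K : ℝ → V → E} {t c : ℝ} (hK : DuhamelKernel K t c) :
    DuhamelKernel (fun τ z => τ • K τ z) t (t * c) where
  meas := measurable_fst.stronglyMeasurable.smul hK.meas
  bound := fun τ hτ z => by
    rw [norm_smul, Real.norm_of_nonneg hτ.1.le, mul_assoc]
    exact mul_le_mul hτ.2.le (hK.bound τ hτ z) (norm_nonneg _) (hτ.1.trans hτ.2).le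

/-- The space-time convolution `∫₀ᵗ ∫ F(s,y) K(t-s,x-y) dy ds`. -/
def duhamel (K : ℝ → V → E) (F : ℝ → V → ℝ) (t : ℝ) (x : V) : E :=
  ∫ q, F q.1 q.2 • K (t - q.1) (x - q.2) ∂slab V t

theorem norm_duhamel_integrand_le {K : ℝ → V → E} {F : ℝ → V → ℝ} {p : ℕ} {t c D : ℝ}
    (hK : DuhamelKernel K t c) (hF : DuhamelSource F p D) (x : V) {q : ℝ × V} (hq : q.1 ∈ Ioo 0 t) :
    ‖F q.1 q.2 • K (t - q.1) (x - q.2)‖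
      ≤ c * D * (2 ^ (finrank ℝ V + 1) * ((√t + ‖x‖) ^ p)⁻¹) *
        (((√(t - q.1) + ‖x - q.2‖) ^ (finrank ℝ V + 1))⁻¹
          + ((√q.1 + ‖q.2‖) ^ (finrank ℝ V + 1))⁻¹) := by
  have ht : 0 < t := hq.1.trans hq.2
  have hc := hK.const_nonneg ht
  have hD := hF.decay.const_nonneg
  have : 0 < √q.1 := Real.sqrt_pos.2 hq.1
  have : 0 < √(t - q.1) := Real.sqrt_pos.2 (sub_pos.2 hq.2)
  have : 0 < √t := Real.sqrt_pos.2 ht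
  rw [norm_smul]
  calc _ ≤ (D * ((√q.1 + ‖q.2‖) ^ p)⁻¹)
        * (c * ((√(t - q.1) + ‖x - q.2‖) ^ (finrank ℝ V + 1))⁻¹) := by
        gcongr
        · exact hF.decay _ hq.1 _
        · exact hK.bound _ ⟨sub_pos.2 hq.2, sub_lt_self t hq.1⟩ _
    _ = c * D * (((√(t - q.1) + ‖x - q.2‖) ^ (finrank ℝ V + 1))⁻¹
          * ((√q.1 + ‖q.2‖) ^ p)⁻¹) := by ring
    _ ≤ c * D * (2 ^ (finrank ℝ V + 1) * ((√t + ‖x‖) ^ p)⁻¹ *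
        (((√(t - q.1) + ‖x - q.2‖) ^ (finrank ℝ V + 1))⁻¹
          + ((√q.1 + ‖q.2‖) ^ (finrank ℝ V + 1))⁻¹)) :=
        mul_le_mul_of_nonneg_left (inv_pow_mul_inv_pow_le (by positivity) (by positivity)
          (by positivity) (parabolic_triangle hq.1.le hq.2.le x q.2) hF.exponent_le)
          (mul_nonneg hc hD)
    _ = _ := by ring

end

variable [FiniteDimensional ℝ V] [BorelSpace V]
  [(volume : Measure V).IsAddHaarMeasure]

theorem integrable_inv_add_norm_pow {σ : ℝ} (hσ : 0 < σ) :
    Integrable fun x : V => ((σ + ‖x‖) ^ (finrank ℝ V + 1))⁻¹ := by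
  have hone : Integrable fun x : V => ((1 + ‖x‖) ^ (finrank ℝ V + 1))⁻¹ := by
    refine (integrable_one_add_norm (E := V) (r := finrank ℝ V + 1) (by simp)).congr
      (.of_forall fun x => ?_)
    simp only [Real.rpow_neg (show 0 ≤ 1 + ‖x‖ by positivity)]
    norm_cast
  simp only [inv_add_norm_pow_scaling hσ]
  exact (hone.comp_smul (inv_ne_zero hσ.ne')).const_mul _

theorem integral_inv_add_norm_pow {σ : ℝ} (hσ : 0 < σ) :
    ∫ x : V, ((σ + ‖x‖) ^ (finrank ℝ V + 1))⁻¹ = weightIntegral V * σ⁻¹ := by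
  simp only [inv_add_norm_pow_scaling hσ]
  rw [integral_const_mul,
    Measure.integral_comp_smul volume (fun x : V => ((1 + ‖x‖) ^ (finrank ℝ V + 1))⁻¹),
    smul_eq_mul, abs_of_pos (by positivity), weightIntegral, inv_pow, inv_inv, pow_succ]
  field_simp

theorem measurePreserving_slab_reflect (t : ℝ) (x : V) :
    MeasurePreserving ((MeasurableEquiv.subLeft t).prodCongr (MeasurableEquiv.subLeft x))
      (slab V t) (slab V t) := by
  have htime := (Measure.measurePreserving_sub_left (volume : Measure ℝ) t).restrict_preimage
    (measurableSet_Ioo (a := 0) (b := t))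
  simp only [preimage_const_sub_Ioo, sub_self, sub_zero] at htime
  exact htime.prod (Measure.measurePreserving_sub_left volume x)

theorem integrable_slab_inv_pow (t : ℝ) :
    Integrable (fun q : ℝ × V => ((√q.1 + ‖q.2‖) ^ (finrank ℝ V + 1))⁻¹) (slab V t) := by
  refine (integrable_prod_iff (by fun_prop)).2 ⟨?_, ?_⟩
  · filter_upwards [ae_restrict_mem measurableSet_Ioo] with s hs using
      integrable_inv_add_norm_pow (Real.sqrt_pos.2 hs.1)
  · refine ((integrableOn_inv_sqrt t).const_mul (weightIntegral V)).congr ?_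
    filter_upwards [ae_restrict_mem measurableSet_Ioo] with s hs
    rw [← integral_inv_add_norm_pow (Real.sqrt_pos.2 hs.1)]
    exact integral_congr_ae (.of_forall fun y => (Real.norm_of_nonneg (by positivity)).symm)

theorem integral_slab_inv_pow {t : ℝ} (ht : 0 ≤ t) :
    ∫ q : ℝ × V, ((√q.1 + ‖q.2‖) ^ (finrank ℝ V + 1))⁻¹ ∂slab V t
      = 2 * weightIntegral V * √t := by
  have hfib : ∫ s in Ioo 0 t, ∫ y : V, ((√s + ‖y‖) ^ (finrank ℝ V + 1))⁻¹
      = ∫ s in Ioo 0 t, weightIntegral V * (√s)⁻¹ :=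
    setIntegral_congr_fun measurableSet_Ioo fun s hs =>
      integral_inv_add_norm_pow (Real.sqrt_pos.2 hs.1)
  rw [slab, integral_prod _ (integrable_slab_inv_pow t), hfib, integral_const_mul,
    integral_inv_sqrt ht]
  ring

variable [NormedSpace ℝ E] {K : ℝ → V → E} {F G : ℝ → V → ℝ} {p : ℕ} {t c C D : ℝ}

theorem integrable_slab_inv_pow_reflect (t : ℝ) (x : V) :
    Integrable (fun q : ℝ × V => ((√(t - q.1) + ‖x - q.2‖) ^ (finrank ℝ V + 1))⁻¹) (slab V t) :=
  (measurePreserving_slab_reflect t x).integrable_comp_of_integrable (integrable_slab_inv_pow t)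

theorem integral_slab_inv_pow_reflect (ht : 0 ≤ t) (x : V) :
    ∫ q : ℝ × V, ((√(t - q.1) + ‖x - q.2‖) ^ (finrank ℝ V + 1))⁻¹ ∂slab V t
      = 2 * weightIntegral V * √t :=
  ((measurePreserving_slab_reflect t x).integral_comp'
    fun q => ((√q.1 + ‖q.2‖) ^ (finrank ℝ V + 1))⁻¹).trans (integral_slab_inv_pow ht)

theorem integrable_duhamel_integrand (hK : DuhamelKernel K t c) (hF : DuhamelSource F p D)
    (x : V) : Integrable (fun q : ℝ × V => F q.1 q.2 • K (t - q.1) (x - q.2)) (slab V t) := by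
  have hKm : StronglyMeasurable fun q : ℝ × V => K (t - q.1) (x - q.2) :=
    hK.meas.comp_measurable (g := fun q : ℝ × V => (t - q.1, x - q.2)) (by fun_prop)
  refine Integrable.mono' (g := fun q => c * D * (2 ^ (finrank ℝ V + 1) * ((√t + ‖x‖) ^ p)⁻¹) *
      (((√(t - q.1) + ‖x - q.2‖) ^ (finrank ℝ V + 1))⁻¹
        + ((√q.1 + ‖q.2‖) ^ (finrank ℝ V + 1))⁻¹))
    (((integrable_slab_inv_pow_reflect t x).add (integrable_slab_inv_pow t)).const_mul _)
    ((hF.meas.mono_measure (slab_le_spaceTime t)).smul hKm.aestronglyMeasurable) ?_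
  filter_upwards [ae_slab_mem_Ioo t] with q hq using norm_duhamel_integrand_le hK hF x hq

theorem integral_norm_duhamel_integrand_le (ht : 0 < t) (hK : DuhamelKernel K t c)
    (hF : DuhamelSource F p D) (x : V) :
    ∫ q : ℝ × V, ‖F q.1 q.2 • K (t - q.1) (x - q.2)‖ ∂slab V t
      ≤ duhamelConst V * c * D * √t * ((√t + ‖x‖) ^ p)⁻¹ := by
  calc _ ≤ ∫ q : ℝ × V, c * D * (2 ^ (finrank ℝ V + 1) * ((√t + ‖x‖) ^ p)⁻¹) *
        (((√(t - q.1) + ‖x - q.2‖) ^ (finrank ℝ V + 1))⁻¹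
          + ((√q.1 + ‖q.2‖) ^ (finrank ℝ V + 1))⁻¹) ∂slab V t :=
        integral_mono_ae (integrable_duhamel_integrand hK hF x).norm
          (((integrable_slab_inv_pow_reflect t x).add (integrable_slab_inv_pow t)).const_mul _)
          ((ae_slab_mem_Ioo t).mono fun q hq => norm_duhamel_integrand_le hK hF x hq)
    _ = _ := by
        rw [integral_const_mul, integral_add (integrable_slab_inv_pow_reflect t x)
          (integrable_slab_inv_pow t), integral_slab_inv_pow_reflect ht.le,
          integral_slab_inv_pow ht.le, duhamelConst]
        ring

theorem norm_duhamel_le (ht : 0 < t) (hK : DuhamelKernel K t c) (hF : DuhamelSource F p D)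
    (x : V) : ‖duhamel K F t x‖ ≤ duhamelConst V * c * D * √t * ((√t + ‖x‖) ^ p)⁻¹ :=
  (norm_integral_le_integral_norm _).trans (integral_norm_duhamel_integrand_le ht hK hF x)

theorem aestronglyMeasurable_duhamel (hK : StronglyMeasurable (Function.uncurry K))
    (hF : AEStronglyMeasurable (Function.uncurry F) (spaceTime V)) :
    AEStronglyMeasurable (Function.uncurry (duhamel K F)) (spaceTime V) := by
  have hrestrict (z : ℝ × V) : Function.uncurry (duhamel K F) z
      = ∫ q, {q : ℝ × V | q.1 < z.1}.indicator
          (fun q => F q.1 q.2 • K (z.1 - q.1) (z.2 - q.2)) q ∂spaceTime V := by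
    rw [integral_indicator (measurableSet_lt measurable_fst measurable_const), ← slab_eq_restrict]
    rfl
  have hprod : AEStronglyMeasurable ({z : (ℝ × V) × (ℝ × V) | z.2.1 < z.1.1}.indicator
      fun z => F z.2.1 z.2.2 • K (z.1.1 - z.2.1) (z.1.2 - z.2.2))
      ((spaceTime V).prod (spaceTime V)) := by
    have hKm : StronglyMeasurable fun z : (ℝ × V) × (ℝ × V) =>
        K (z.1.1 - z.2.1) (z.1.2 - z.2.2) :=
      hK.comp_measurable (g := fun z : (ℝ × V) × (ℝ × V) => (z.1.1 - z.2.1, z.1.2 - z.2.2))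
        (by fun_prop)
    exact (hF.comp_snd.smul hKm.aestronglyMeasurable).indicator
      (measurableSet_lt (by fun_prop) (by fun_prop))
  exact hprod.integral_prod_right'.congr (.of_forall fun z => (hrestrict z).symm)

theorem duhamel_sub (hK : DuhamelKernel K t c) (hF : DuhamelSource F p C)
    (hG : DuhamelSource G p D) (x : V) :
    duhamel K (fun s y => F s y - G s y) t x = duhamel K F t x - duhamel K G t x := by
  simp only [duhamel, sub_smul]
  exact integral_sub (integrable_duhamel_integrand hK hF x) (integrable_duhamel_integrand hK hG x)

end Duhamel

theorem boundedSolenoidal_duhamel {K : ℝ → E3 → E3} {F : ℝ → E3 → ℝ} {p : ℕ} {t c D : ℝ}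
    (ht : 0 < t) (hK : DuhamelKernel K t c) (hF : DuhamelSource F p D)
    (hdiv : ∀ τ, 0 < τ → IsDivFree (K τ)) : BoundedSolenoidal (duhamel K F t) := by
  have hKm : StronglyMeasurable fun z : E3 × (ℝ × E3) => K (t - z.2.1) (z.1 - z.2.2) :=
    hK.meas.comp_measurable (g := fun z : E3 × (ℝ × E3) => (t - z.2.1, z.1 - z.2.2)) (by fun_prop)
  have : 0 < √t := Real.sqrt_pos.2 ht
  refine BoundedSolenoidal.integral (C := duhamelConst E3 * c * D * √t * (√t ^ p)⁻¹)
    ((hF.meas.mono_measure (slab_le_spaceTime t)).comp_snd.smul hKm.aestronglyMeasurable)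
    (integrable_duhamel_integrand hK hF)
    (fun x => (integral_norm_duhamel_integrand_le ht hK hF x).trans ?_) ?_
  · have := hK.const_nonneg ht
    have := hF.decay.const_nonneg
    have := duhamelConst_nonneg (V := E3)
    gcongr
    exact le_add_of_nonneg_right (norm_nonneg x)
  · filter_upwards [ae_slab_mem_Ioo t] with q hq using
      ((hdiv _ (sub_pos.2 hq.2)).comp_sub_right q.2).const_smul _

/-! ### Free evolutions -/

section InvNorm

open Module (finrank)

variable {V : Type*} [NormedAddCommGroup V]

theorem mul_inv_pow_mul_inv_norm_le {σ : ℝ} (hσ : 0 < σ) (n : ℕ) (x y : V) :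
    σ * ((σ + ‖x - y‖) ^ (n + 1))⁻¹ * ‖y‖⁻¹ ≤
      2 * (σ + ‖x‖)⁻¹ * (σ * ((σ + ‖x - y‖) ^ (n + 1))⁻¹) + 2 ^ (n + 1) * ((σ + ‖x‖) ^ n)⁻¹ *
        (Metric.ball (0 : V) (σ + ‖x‖)).indicator (fun x => ‖x‖⁻¹) y := by
  have hR : 0 < σ + ‖x‖ := by positivity
  rcases le_or_gt ((σ + ‖x‖) / 2) ‖y‖ with hfar | hnear
  · have hy : ‖y‖⁻¹ ≤ 2 * (σ + ‖x‖)⁻¹ := by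
      calc ‖y‖⁻¹ ≤ ((σ + ‖x‖) / 2)⁻¹ := by gcongr
        _ = _ := by rw [inv_div, div_eq_mul_inv]
    calc _ ≤ σ * ((σ + ‖x - y‖) ^ (n + 1))⁻¹ * (2 * (σ + ‖x‖)⁻¹) := by gcongr
      _ = 2 * (σ + ‖x‖)⁻¹ * (σ * ((σ + ‖x - y‖) ^ (n + 1))⁻¹) := mul_comm _ _
      _ ≤ _ := le_add_of_nonneg_right
        (mul_nonneg (by positivity) (indicator_nonneg (fun x _ => by positivity) y))
  · rw [indicator_of_mem (by rw [mem_ball_zero_iff]; linarith)]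
    have htri : ‖x‖ ≤ ‖x - y‖ + ‖y‖ := by simpa using norm_add_le (x - y) y
    have hA : (σ + ‖x‖) / 2 ≤ σ + ‖x - y‖ := by linarith
    calc σ * ((σ + ‖x - y‖) ^ (n + 1))⁻¹ * ‖y‖⁻¹
        ≤ (σ + ‖x‖) * (((σ + ‖x‖) / 2) ^ (n + 1))⁻¹ * ‖y‖⁻¹ := by
          gcongr
          exact le_add_of_nonneg_right (norm_nonneg x)
      _ = 2 ^ (n + 1) * ((σ + ‖x‖) ^ n)⁻¹ * ‖y‖⁻¹ := by
          rw [div_pow, inv_div, pow_succ (σ + ‖x‖)]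
          field_simp
      _ ≤ _ := le_add_of_nonneg_left (by positivity)

variable [NormedSpace ℝ V] [MeasureSpace V] {σ : ℝ}

variable (V) in
/-- The constant `∫ |x|⁻¹ dx` over the unit ball. -/
def ballIntegral : ℝ := ∫ x in Metric.ball (0 : V) 1, ‖x‖⁻¹

variable (V) in
/-- The constant in `integral_mul_inv_pow_mul_inv_norm_le`. -/
def singularConst : ℝ := 2 * weightIntegral V + 2 ^ (finrank ℝ V + 1) * ballIntegral V

theorem singularConst_nonneg : 0 ≤ singularConst V :=
  add_nonneg (mul_nonneg zero_le_two (integral_nonneg fun x => by positivity))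
    (mul_nonneg (by positivity) (integral_nonneg fun x => by positivity))

variable [FiniteDimensional ℝ V] [BorelSpace V] [(volume : Measure V).IsAddHaarMeasure]

theorem integrableOn_inv_norm_ball (hV : 1 < finrank ℝ V) (R : ℝ) :
    IntegrableOn (fun x : V => ‖x‖⁻¹) (Metric.ball 0 R) := by
  have : Nontrivial V := Module.nontrivial_of_finrank_pos (zero_lt_one.trans hV)
  refine (integrableOn_fun_norm_addHaar volume (f := fun r => r⁻¹)).2 ?_
  have hpow : IntegrableOn (fun r : ℝ => r ^ (finrank ℝ V - 2)) (Ioo 0 R) :=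
    ((continuous_pow _).integrableOn_Icc (a := 0) (b := R)).mono_set Ioo_subset_Icc_self
  refine hpow.congr_fun (fun r hr => ?_) measurableSet_Ioo
  have hsucc : finrank ℝ V - 1 = finrank ℝ V - 2 + 1 := by omega
  have := hr.1.ne'
  simp only [hsucc, pow_succ, smul_eq_mul]
  field_simp

theorem integral_inv_norm_ball {R : ℝ} (hR : 0 < R) :
    ∫ x in Metric.ball (0 : V) R, ‖x‖⁻¹ = R ^ finrank ℝ V * R⁻¹ * ballIntegral V := by
  have hscale := Measure.setIntegral_comp_smul_of_pos (volume : Measure V) (fun x => ‖x‖⁻¹)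
    (Metric.ball 0 1) hR
  simp only [norm_smul, Real.norm_of_nonneg hR.le, mul_inv, smul_unitBall_of_pos hR,
    integral_const_mul, smul_eq_mul] at hscale
  rw [ballIntegral, mul_assoc, hscale]
  field_simp

theorem integrable_inv_pow_sub (hσ : 0 < σ) (x : V) :
    Integrable fun y : V => ((σ + ‖x - y‖) ^ (finrank ℝ V + 1))⁻¹ :=
  (integrable_inv_add_norm_pow hσ).comp_sub_left x

theorem integral_inv_pow_sub (hσ : 0 < σ) (x : V) :
    ∫ y : V, ((σ + ‖x - y‖) ^ (finrank ℝ V + 1))⁻¹ = weightIntegral V * σ⁻¹ :=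
  (integral_sub_left_eq_self (fun y : V => ((σ + ‖y‖) ^ (finrank ℝ V + 1))⁻¹) volume x).trans
    (integral_inv_add_norm_pow hσ)

theorem integrable_mul_inv_norm_majorant (hV : 1 < finrank ℝ V) (hσ : 0 < σ) (x : V) :
    Integrable fun y : V => 2 * (σ + ‖x‖)⁻¹ * (σ * ((σ + ‖x - y‖) ^ (finrank ℝ V + 1))⁻¹) +
      2 ^ (finrank ℝ V + 1) * ((σ + ‖x‖) ^ finrank ℝ V)⁻¹ *
        (Metric.ball (0 : V) (σ + ‖x‖)).indicator (fun x => ‖x‖⁻¹) y :=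
  (((integrable_inv_pow_sub hσ x).const_mul σ).const_mul _).add
    (((integrableOn_inv_norm_ball hV _).integrable_indicator measurableSet_ball).const_mul _)

theorem integrable_mul_inv_pow_mul_inv_norm (hV : 1 < finrank ℝ V) (hσ : 0 < σ) (x : V) :
    Integrable fun y : V => σ * ((σ + ‖x - y‖) ^ (finrank ℝ V + 1))⁻¹ * ‖y‖⁻¹ := by
  refine (integrable_mul_inv_norm_majorant hV hσ x).mono'
    (Measurable.aestronglyMeasurable (by fun_prop)) (.of_forall fun y => ?_)
  rw [Real.norm_of_nonneg (by positivity)]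
  exact mul_inv_pow_mul_inv_norm_le hσ _ x y

theorem integral_mul_inv_pow_mul_inv_norm_le (hV : 1 < finrank ℝ V) (hσ : 0 < σ) (x : V) :
    ∫ y : V, σ * ((σ + ‖x - y‖) ^ (finrank ℝ V + 1))⁻¹ * ‖y‖⁻¹
      ≤ singularConst V * (σ + ‖x‖)⁻¹ := by
  have hR : 0 < σ + ‖x‖ := by positivity
  calc _ ≤ _ := integral_mono (integrable_mul_inv_pow_mul_inv_norm hV hσ x)
        (integrable_mul_inv_norm_majorant hV hσ x) fun y => mul_inv_pow_mul_inv_norm_le hσ _ x y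
    _ = 2 * (σ + ‖x‖)⁻¹ * (σ * (weightIntegral V * σ⁻¹)) +
          2 ^ (finrank ℝ V + 1) * ((σ + ‖x‖) ^ finrank ℝ V)⁻¹ *
            ((σ + ‖x‖) ^ finrank ℝ V * (σ + ‖x‖)⁻¹ * ballIntegral V) := by
        rw [integral_add (((integrable_inv_pow_sub hσ x).const_mul σ).const_mul _)
          (((integrableOn_inv_norm_ball hV _).integrable_indicator measurableSet_ball).const_mul _),
          integral_const_mul, integral_const_mul, integral_const_mul, integral_inv_pow_sub hσ,
          integral_indicator measurableSet_ball, integral_inv_norm_ball hR]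
    _ = _ := by
        rw [singularConst]
        field_simp

end InvNorm

section HeatFlow

theorem measurable_heatKernel : Measurable fun p : ℝ × E3 => heatKernel p.1 p.2 := by
  unfold heatKernel
  fun_prop

/-- A measurable vector field with `|u₀(y)| ≤ ε |y|⁻¹`. -/
structure CriticalField (u₀ : E3 → E3) (ε : ℝ) : Prop where
  meas : AEStronglyMeasurable u₀ volume
  bound : ∀ y, ‖y‖ * ‖u₀ y‖ ≤ ε

theorem aestronglyMeasurable_heatFlow {u₀ : E3 → E3} (hm : AEStronglyMeasurable u₀ volume) :
    AEStronglyMeasurable (Function.uncurry (heatFlow u₀)) (spaceTime E3) := by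
  have hG : Measurable fun z : (ℝ × E3) × E3 => heatKernel z.1.1 (z.1.2 - z.2) :=
    measurable_heatKernel.comp (g := fun p : ℝ × E3 => heatKernel p.1 p.2)
      (f := fun z : (ℝ × E3) × E3 => (z.1.1, z.1.2 - z.2)) (by fun_prop)
  exact (hG.aestronglyMeasurable.smul hm.comp_snd).integral_prod_right'

theorem finrank_E3 : Module.finrank ℝ E3 = 3 := finrank_euclideanSpace_fin

variable {u₀ : E3 → E3} {ε C t : ℝ}

theorem norm_heatKernel_smul_le (hC : ParabolicDecay (rescale 4 (heatSchwartz 1)) 4 C)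
    (h : CriticalField u₀ ε) (ht : 0 < t) (x : E3) {y : E3} (hy : y ≠ 0) :
    ‖heatKernel t (x - y) • u₀ y‖ ≤
      C * ε * (√t * ((√t + ‖x - y‖) ^ (Module.finrank ℝ E3 + 1))⁻¹ * ‖y‖⁻¹) := by
  have hσ : 0 < √t := Real.sqrt_pos.2 ht
  have hu : ‖u₀ y‖ ≤ ε * ‖y‖⁻¹ := by
    rw [← div_eq_mul_inv, le_div_iff₀' (norm_pos_iff.2 hy)]
    exact h.bound y
  have hheat : heatKernel t (x - y) = √t * rescale 4 (heatSchwartz 1) t (x - y) := by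
    rw [heatKernel_eq_rescale ht, rescale, rescale, smul_eq_mul, smul_eq_mul]
    field_simp
  rw [norm_smul, hheat, norm_mul, Real.norm_of_nonneg hσ.le, finrank_E3]
  have := hC.const_nonneg
  calc _ ≤ √t * (C * ((√t + ‖x - y‖) ^ 4)⁻¹) * (ε * ‖y‖⁻¹) := by gcongr; exact hC t ht _
    _ = _ := by ring

theorem ae_norm_heatKernel_smul_le (hC : ParabolicDecay (rescale 4 (heatSchwartz 1)) 4 C)
    (h : CriticalField u₀ ε) (ht : 0 < t) (x : E3) :
    ∀ᵐ y : E3, ‖heatKernel t (x - y) • u₀ y‖ ≤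
      C * ε * (√t * ((√t + ‖x - y‖) ^ (Module.finrank ℝ E3 + 1))⁻¹ * ‖y‖⁻¹) :=
  (Measure.ae_ne volume 0).mono fun _ hy => norm_heatKernel_smul_le hC h ht x hy

theorem integrable_heatKernel_smul (h : CriticalField u₀ ε) (ht : 0 < t) (x : E3) :
    Integrable fun y => heatKernel t (x - y) • u₀ y := by
  obtain ⟨C, -, hC⟩ := exists_parabolicDecay_rescale 4 (heatSchwartz 1)
  have hG : Measurable fun y => heatKernel t (x - y) := by
    unfold heatKernel
    fun_prop
  exact ((integrable_mul_inv_pow_mul_inv_norm (by simp) (Real.sqrt_pos.2 ht) x).const_mul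
    (C * ε)).mono' (hG.aestronglyMeasurable.smul h.meas) (ae_norm_heatKernel_smul_le hC h ht x)

theorem integral_norm_heatKernel_smul_le
    (hC : ParabolicDecay (rescale 4 (heatSchwartz 1)) 4 C) (h : CriticalField u₀ ε) (ht : 0 < t)
    (x : E3) : ∫ y, ‖heatKernel t (x - y) • u₀ y‖
      ≤ C * singularConst E3 * ε * (√t + ‖x‖)⁻¹ := by
  have hσ := Real.sqrt_pos.2 ht
  have hε : 0 ≤ ε := by simpa using h.bound 0
  calc _ ≤ _ := integral_mono_ae (integrable_heatKernel_smul h ht x).norm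
        ((integrable_mul_inv_pow_mul_inv_norm (by simp) hσ x).const_mul (C * ε))
        (ae_norm_heatKernel_smul_le hC h ht x)
    _ ≤ C * ε * (singularConst E3 * (√t + ‖x‖)⁻¹) := by
        rw [integral_const_mul]
        exact mul_le_mul_of_nonneg_left (integral_mul_inv_pow_mul_inv_norm_le (by simp) hσ x)
          (mul_nonneg hC.const_nonneg hε)
    _ = _ := by ring

theorem exists_parabolicDecay_heatFlow : ∃ C, 0 ≤ C ∧ ∀ (u₀ : E3 → E3) (ε : ℝ),
    CriticalField u₀ ε → ParabolicDecay (heatFlow u₀) 1 (C * ε) := by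
  obtain ⟨C, hC0, hC⟩ := exists_parabolicDecay_rescale 4 (heatSchwartz 1)
  refine ⟨C * singularConst E3, mul_nonneg hC0 singularConst_nonneg, fun u₀ ε h t ht x => ?_⟩
  rw [pow_one]
  exact (norm_integral_le_integral_norm _).trans (integral_norm_heatKernel_smul_le hC h ht x)

theorem boundedSolenoidal_heatFlow (h : CriticalField u₀ ε) (hdiv : IsDivFree u₀) (ht : 0 < t) :
    BoundedSolenoidal (heatFlow u₀ t) := by
  obtain ⟨C, hC0, hC⟩ := exists_parabolicDecay_rescale 4 (heatSchwartz 1)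
  have hrefl (x z : E3) : heatKernel t z • u₀ (x - z) =
      heatKernel t (x - (x - z)) • u₀ (x - z) := by rw [sub_sub_cancel]
  have hflow : heatFlow u₀ t = fun x => ∫ z, heatKernel t z • u₀ (x - z) := by
    ext1 x
    simp only [hrefl]
    exact (integral_sub_left_eq_self (fun y => heatKernel t (x - y) • u₀ y) volume x).symm
  have hG : Measurable fun p : E3 × E3 => heatKernel t p.2 := by
    unfold heatKernel
    fun_prop
  rw [hflow]
  refine BoundedSolenoidal.integral (C := C * singularConst E3 * ε * (√t)⁻¹)
    (hG.aestronglyMeasurable.smul (h.meas.comp_quasiMeasurePreserving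
      (quasiMeasurePreserving_sub_of_right_invariant volume volume))) (fun x => ?_) (fun x => ?_)
    (.of_forall fun z => (hdiv.comp_sub_right z).const_smul _)
  · simpa only [hrefl] using (integrable_heatKernel_smul h ht x).comp_sub_left x
  · have := Real.sqrt_pos.2 ht
    have hε : 0 ≤ ε := by simpa using h.bound 0
    have := singularConst_nonneg (V := E3)
    simp only [hrefl]
    rw [integral_sub_left_eq_self (fun y => ‖heatKernel t (x - y) • u₀ y‖) volume x]
    refine (integral_norm_heatKernel_smul_le hC h ht x).trans ?_
    gcongr
    exact le_add_of_nonneg_right (norm_nonneg x)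

end HeatFlow

section LerayHeatFlow

theorem inv_cube_mul_inv_cube_le {σ A B : ℝ} (hσ : 0 < σ) (hA : σ ≤ A) (hB : σ ≤ B) :
    (A ^ 3)⁻¹ * (B ^ 3)⁻¹ ≤ (σ ^ 2)⁻¹ * ((A ^ 4)⁻¹ + (B ^ 4)⁻¹) := by
  have := hσ.trans_le hA
  have := hσ.trans_le hB
  have hfour (m : ℝ) : (m ^ 4)⁻¹ = (m ^ 2)⁻¹ ^ 2 := by rw [inv_pow, ← pow_mul]
  have hyoung : (A ^ 2)⁻¹ * (B ^ 2)⁻¹ ≤ (A ^ 4)⁻¹ + (B ^ 4)⁻¹ := by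
    rw [hfour A, hfour B]
    nlinarith [sq_nonneg ((A ^ 2)⁻¹ - (B ^ 2)⁻¹), sq_nonneg (A ^ 2)⁻¹, sq_nonneg (B ^ 2)⁻¹]
  calc (A ^ 3)⁻¹ * (B ^ 3)⁻¹ = (A * B)⁻¹ * ((A ^ 2)⁻¹ * (B ^ 2)⁻¹) := by field_simp
    _ ≤ (σ * σ)⁻¹ * ((A ^ 4)⁻¹ + (B ^ 4)⁻¹) := by gcongr
    _ = _ := by rw [sq]

/-- The integrand of `e^{tΔ} ℙ(θ₀ e₃)`, as a superposition of translates of a column of the Oseen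
kernel. -/
def lerayHeatIntegrand (θ₀ : RealTempered) (t : ℝ) (x y : E3) : E3 :=
  heatFlowDistr θ₀ (t / 2) y • lerayColumn 0 (heatSchwartz 1) 2 (t / 2) (x - y)

theorem measurable_lerayHeatIntegrand (θ₀ : RealTempered) :
    Measurable fun z : (ℝ × E3) × E3 => lerayHeatIntegrand θ₀ z.1.1 z.1.2 z.2 :=
  ((measurable_heatFlowDistr θ₀).comp (f := fun z : (ℝ × E3) × E3 => (z.1.1 / 2, z.2))
    (by fun_prop)).smul ((measurable_lerayColumn 0 (heatSchwartz 1) 2).comp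
      (f := fun z : (ℝ × E3) × E3 => (z.1.1 / 2, z.1.2 - z.2)) (by fun_prop))

variable {θ₀ : RealTempered} {ε t : ℝ}

theorem exists_norm_lerayHeatIntegrand_le (hθ : ParabolicDecay (heatFlowDistr θ₀) 3 ε)
    (ht : 0 < t) : ∃ C, ∀ x y, ‖lerayHeatIntegrand θ₀ t x y‖ ≤
      C * (((√(t / 2) + ‖x - y‖) ^ (Module.finrank ℝ E3 + 1))⁻¹
        + ((√(t / 2) + ‖y‖) ^ (Module.finrank ℝ E3 + 1))⁻¹) := by
  obtain ⟨C, hC0, hC⟩ := exists_parabolicDecay_lerayColumn 0 (heatSchwartz 1) 2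
  have hσ := Real.sqrt_pos.2 (half_pos ht)
  have := hθ.const_nonneg
  refine ⟨ε * C * (√(t / 2) ^ 2)⁻¹, fun x y => ?_⟩
  rw [lerayHeatIntegrand, norm_smul, finrank_E3]
  calc _ ≤ ε * ((√(t / 2) + ‖y‖) ^ 3)⁻¹ * (C * ((√(t / 2) + ‖x - y‖) ^ 3)⁻¹) :=
        mul_le_mul (hθ _ (half_pos ht) y) (hC _ (half_pos ht) _) (norm_nonneg _) (by positivity)
    _ = ε * C * (((√(t / 2) + ‖x - y‖) ^ 3)⁻¹ * ((√(t / 2) + ‖y‖) ^ 3)⁻¹) := by ring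
    _ ≤ ε * C * ((√(t / 2) ^ 2)⁻¹ * (((√(t / 2) + ‖x - y‖) ^ 4)⁻¹
          + ((√(t / 2) + ‖y‖) ^ 4)⁻¹)) :=
        mul_le_mul_of_nonneg_left (inv_cube_mul_inv_cube_le hσ
          (le_add_of_nonneg_right (norm_nonneg _)) (le_add_of_nonneg_right (norm_nonneg _)))
          (by positivity)
    _ = _ := by ring

theorem integrable_lerayHeatIntegrand (hθ : ParabolicDecay (heatFlowDistr θ₀) 3 ε) (ht : 0 < t)
    (x : E3) : Integrable (lerayHeatIntegrand θ₀ t x) := by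
  obtain ⟨C, hC⟩ := exists_norm_lerayHeatIntegrand_le hθ ht
  have hσ := Real.sqrt_pos.2 (half_pos ht)
  exact (((integrable_inv_pow_sub hσ x).add (integrable_inv_add_norm_pow hσ)).const_mul C).mono'
    ((measurable_lerayHeatIntegrand θ₀).comp
      (f := fun y : E3 => ((t, x), y)) (by fun_prop)).aestronglyMeasurable (.of_forall (hC x))

theorem lerayHeatFlowDistr_eq_integral (hθ : ParabolicDecay (heatFlowDistr θ₀) 3 ε) (ht : 0 < t)
    (x : E3) : lerayHeatFlowDistr θ₀ t x = ∫ y, lerayHeatIntegrand θ₀ t x y := by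
  ext j
  rw [eval_integral_piLp fun i => (integrable_lerayHeatIntegrand hθ ht x).eval_piLp i]
  simp only [lerayHeatFlowDistr, oseenKernel_eq_lerayKernel _ _ (half_pos ht), mul_comm,
    lerayHeatIntegrand, lerayColumn, PiLp.smul_apply, smul_eq_mul]

theorem ae_spaceTime_pos {V : Type*} [MeasureSpace V] : ∀ᵐ p ∂spaceTime V, 0 < p.1 :=
  (ae_restrict_mem (measurableSet_Ioi.prod .univ)).mono fun _ hp => hp.1

theorem aestronglyMeasurable_lerayHeatFlowDistr (hθ : ParabolicDecay (heatFlowDistr θ₀) 3 ε) :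
    AEStronglyMeasurable (Function.uncurry (lerayHeatFlowDistr θ₀)) (spaceTime E3) := by
  refine ((measurable_lerayHeatIntegrand θ₀).stronglyMeasurable.integral_prod_right'
    (ν := volume)).aestronglyMeasurable.congr ?_
  filter_upwards [ae_spaceTime_pos] with p hp using
    (lerayHeatFlowDistr_eq_integral hθ hp p.2).symm

theorem boundedSolenoidal_lerayHeatFlowDistr (hθ : ParabolicDecay (heatFlowDistr θ₀) 3 ε)
    (ht : 0 < t) : BoundedSolenoidal (lerayHeatFlowDistr θ₀ t) := by
  obtain ⟨C, hC⟩ := exists_norm_lerayHeatIntegrand_le hθ ht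
  have hσ := Real.sqrt_pos.2 (half_pos ht)
  rw [funext (lerayHeatFlowDistr_eq_integral hθ ht)]
  refine BoundedSolenoidal.integral (w := fun y x => lerayHeatIntegrand θ₀ t x y)
    (C := C * (weightIntegral E3 * (√(t / 2))⁻¹ + weightIntegral E3 * (√(t / 2))⁻¹))
    ((measurable_lerayHeatIntegrand θ₀).comp (f := fun p : E3 × E3 => ((t, p.1), p.2))
      (by fun_prop)).aestronglyMeasurable (integrable_lerayHeatIntegrand hθ ht) (fun x => ?_)
    (.of_forall fun y => ((isDivFree_oseenColumn 2 (half_pos ht)).comp_sub_right y).const_smul _)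
  calc _ ≤ _ := integral_mono (integrable_lerayHeatIntegrand hθ ht x).norm
        (((integrable_inv_pow_sub hσ x).add (integrable_inv_add_norm_pow hσ)).const_mul C) (hC x)
    _ = _ := by
        simp only [Pi.add_apply]
        rw [integral_const_mul, integral_add (integrable_inv_pow_sub hσ x)
          (integrable_inv_add_norm_pow hσ), integral_inv_pow_sub hσ, integral_inv_add_norm_pow hσ]

end LerayHeatFlow

/-! ### The quadratic terms -/

theorem sqrt_pow_mul_inv_pow_le {V : Type*} [NormedAddCommGroup V] {t : ℝ} (ht : 0 < t)
    (m n : ℕ) (x : V) :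
    √t ^ m * ((√t + ‖x‖) ^ (n + m))⁻¹ ≤ ((√t + ‖x‖) ^ n)⁻¹ := by
  have : 0 < √t := Real.sqrt_pos.2 ht
  calc √t ^ m * ((√t + ‖x‖) ^ (n + m))⁻¹
      ≤ (√t + ‖x‖) ^ m * ((√t + ‖x‖) ^ (n + m))⁻¹ := by
        gcongr
        exact le_add_of_nonneg_right (norm_nonneg x)
    _ = ((√t + ‖x‖) ^ n)⁻¹ := by rw [pow_add]; field_simp

section

open Module (finrank)

variable {V E : Type*} [NormedAddCommGroup V] [NormedSpace ℝ V] [MeasureSpace V]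
  [FiniteDimensional ℝ V] [BorelSpace V] [(volume : Measure V).IsAddHaarMeasure]
  [NormedAddCommGroup E] [NormedSpace ℝ E] {K : ℝ → V → E} {F : ℝ → V → ℝ} {n : ℕ} {c D : ℝ}

theorem parabolicDecay_duhamel (hK : ∀ t, DuhamelKernel K t c) (hF : DuhamelSource F (n + 1) D) :
    ParabolicDecay (duhamel K F) n (duhamelConst V * c * D) := fun t ht x => by
  have := (hK t).const_nonneg ht
  have := hF.decay.const_nonneg
  have := duhamelConst_nonneg (V := V)
  calc _ ≤ duhamelConst V * c * D * √t * ((√t + ‖x‖) ^ (n + 1))⁻¹ :=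
        norm_duhamel_le ht (hK t) hF x
    _ = duhamelConst V * c * D * (√t ^ 1 * ((√t + ‖x‖) ^ (n + 1))⁻¹) := by ring
    _ ≤ _ := by gcongr; exact sqrt_pow_mul_inv_pow_le ht 1 n x

theorem parabolicDecay_duhamel_time_smul (hK : ∀ t, DuhamelKernel K t c)
    (hF : DuhamelSource F (n + 3) D) :
    ParabolicDecay (duhamel (fun τ z => τ • K τ z) F) n (duhamelConst V * c * D) := fun t ht x => by
  have := (hK t).const_nonneg ht
  have := hF.decay.const_nonneg
  have := duhamelConst_nonneg (V := V)
  calc _ ≤ duhamelConst V * (t * c) * D * √t * ((√t + ‖x‖) ^ (n + 3))⁻¹ :=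
        norm_duhamel_le ht (hK t).time_smul hF x
    _ = duhamelConst V * c * D * (√t ^ 3 * ((√t + ‖x‖) ^ (n + 3))⁻¹) := by
        rw [pow_succ √t 2, Real.sq_sqrt ht.le]
        ring
    _ ≤ _ := by gcongr; exact sqrt_pow_mul_inv_pow_le ht 3 n x

end

/-- The vector kernel `∂_k` of the `l`-th column of the kernel of `e^{tΔ} ℙ`. -/
def oseenGrad (k l : Fin 3) : ℝ → E3 → E3 := lerayColumn 1 (∂_{e k} (heatSchwartz 1)) l

/-- The kernel of `∂_k e^{tΔ}`. -/
def heatGrad (k : Fin 3) : ℝ → E3 → ℝ := rescale 4 (∂_{e k} (heatSchwartz 1))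

theorem pd_oseenKernel (k j l : Fin 3) {t : ℝ} (ht : 0 < t) (x : E3) :
    pd k (oseenKernel j l t) x = oseenGrad k l t x j := by
  rw [oseenKernel_eq_lerayKernel j l ht, pd_lerayKernel 0 _ k j l ht]
  rfl

theorem pd_heatKernel (k : Fin 3) {t : ℝ} (ht : 0 < t) (x : E3) :
    pd k (heatKernel t) x = heatGrad k t x := by
  rw [heatKernel_eq_rescale ht, pd_rescale]
  rfl

theorem stronglyMeasurable_oseenGrad (k l : Fin 3) :
    StronglyMeasurable (Function.uncurry (oseenGrad k l)) :=
  (measurable_lerayColumn _ _ l).stronglyMeasurable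

theorem stronglyMeasurable_heatGrad (k : Fin 3) :
    StronglyMeasurable (Function.uncurry (heatGrad k)) :=
  stronglyMeasurable_rescale 4 _

theorem exists_duhamelKernel_grad : ∃ c, ∀ t,
    (∀ k l, DuhamelKernel (oseenGrad k l) t c) ∧ ∀ k, DuhamelKernel (heatGrad k) t c := by
  choose c _ hc using fun k l =>
    exists_parabolicDecay_lerayColumn 1 (∂_{e k} (heatSchwartz 1)) l
  choose c' _ hc' using fun k => exists_parabolicDecay_rescale 4 (∂_{e k} (heatSchwartz 1))
  obtain ⟨M, hM⟩ := Finite.exists_le fun p : Fin 3 × Fin 3 => max (c p.1 p.2) (c' p.1)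
  have hdim : Module.finrank ℝ E3 + 1 = 4 := by rw [finrank_E3]
  have hoseen (k l) : ParabolicDecay (oseenGrad k l) (Module.finrank ℝ E3 + 1) M :=
    hdim ▸ (hc k l).mono ((le_max_left ..).trans (hM (k, l)))
  have hheat (k) : ParabolicDecay (heatGrad k) (Module.finrank ℝ E3 + 1) M :=
    hdim ▸ (hc' k).mono ((le_max_right ..).trans (hM (k, 0)))
  exact ⟨M, fun t => ⟨fun k l => (hoseen k l).duhamelKernel (stronglyMeasurable_oseenGrad k l) t,
    fun k => (hheat k).duhamelKernel (stronglyMeasurable_heatGrad k) t⟩⟩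

section Decay

variable {V F : Type*} [NormedAddCommGroup V] [NormedAddCommGroup F] {n m : ℕ} {a b A B : ℝ}

theorem ParabolicDecay.neg_sum {ι : Type*} [Fintype ι] {f : ι → ℝ → V → F}
    (hf : ∀ i, ParabolicDecay (f i) n A) :
    ParabolicDecay (fun t x => -∑ i, f i t x) n (Fintype.card ι * A) := fun t ht x => by
  rw [norm_neg]
  exact (norm_sum_le_of_le _ fun i _ => hf i t ht x).trans_eq (by simp [mul_assoc])

theorem ParabolicDecay.mul {f g : ℝ → V → ℝ} (hf : ParabolicDecay f n A)
    (hg : ParabolicDecay g m B) : ParabolicDecay (fun t x => f t x * g t x) (n + m) (A * B) :=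
  fun t ht x => by
    rw [pow_add, mul_inv, mul_mul_mul_comm]
    exact norm_mul_le_of_le (hf t ht x) (hg t ht x)

theorem ParabolicDecay.mul_sub_mul {f f' g g' : ℝ → V → ℝ} (hf' : ParabolicDecay f' n A)
    (hg : ParabolicDecay g m B) (hf : ParabolicDecay (fun t x => f t x - f' t x) n a)
    (hgg' : ParabolicDecay (fun t x => g t x - g' t x) m b) :
    ParabolicDecay (fun t x => f t x * g t x - f' t x * g' t x) (n + m) (a * B + A * b) := by
  convert (hf.mul hg).add (hf'.mul hgg') using 3
  ring

theorem ParabolicDecay.coord {u : ℝ → V → E3} (hu : ParabolicDecay u n A) (k : Fin 3) :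
    ParabolicDecay (fun t x => u t x k) n A :=
  fun t ht x => (PiLp.norm_apply_le _ k).trans (hu t ht x)

end Decay

/-- Pairs `(u, θ)` of a velocity and a temperature depending on time and space. -/
abbrev Flow := (ℝ → E3 → E3) × (ℝ → E3 → ℝ)

/-- `‖u‖_𝓧 ≤ M` and `‖θ‖_𝓨 ≤ M`. -/
structure FlowBound (M : ℝ) (z : Flow) : Prop where
  velocity : ParabolicDecay z.1 1 M
  temperature : ParabolicDecay z.2 3 M

/-- Membership in the closed ball of radius `M` of `𝓧 × 𝓨`. -/
structure Admissible (M : ℝ) (z : Flow) : Prop extends FlowBound M z where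
  measVelocity : AEStronglyMeasurable (Function.uncurry z.1) (spaceTime E3)
  measTemperature : AEStronglyMeasurable (Function.uncurry z.2) (spaceTime E3)

/-- The entries of `u ⊗ u`. -/
def stress (z : Flow) (k l : Fin 3) (s : ℝ) (y : E3) : ℝ := z.1 s y k * z.1 s y l

/-- The components of `θ u`. -/
def flux (z : Flow) (k : Fin 3) (s : ℝ) (y : E3) : ℝ := z.2 s y * z.1 s y k

/-- The quadratic part of the mild formulation. -/
def nonlinearity (z : Flow) : Flow :=
  (fun t x => termB z.1 t x + termE z.1 z.2 t x, fun t x => termBt z.2 z.1 t x)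

section Sources

variable {M d : ℝ} {z w : Flow}

theorem FlowBound.nonneg (h : FlowBound M z) : 0 ≤ M := h.velocity.const_nonneg

theorem Admissible.measVelocity_coord (h : Admissible M z) (k : Fin 3) :
    AEStronglyMeasurable (Function.uncurry fun s y => z.1 s y k) (spaceTime E3) :=
  (EuclideanSpace.proj k : E3 →L[ℝ] ℝ).continuous.comp_aestronglyMeasurable h.measVelocity

theorem Admissible.stress_source (h : Admissible M z) (k l : Fin 3) :
    DuhamelSource (stress z k l) 2 (M * M) where
  meas := (h.measVelocity_coord k).mul (h.measVelocity_coord l)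
  decay := (h.velocity.coord k).mul (h.velocity.coord l)
  exponent_le := by simp

theorem Admissible.flux_source (h : Admissible M z) (k : Fin 3) :
    DuhamelSource (flux z k) 4 (M * M) where
  meas := h.measTemperature.mul (h.measVelocity_coord k)
  decay := h.temperature.mul (h.velocity.coord k)
  exponent_le := by simp

theorem Admissible.stress_sub_source (hz : Admissible M z) (hw : Admissible M w)
    (h : FlowBound d (z - w)) (k l : Fin 3) :
    DuhamelSource (fun s y => stress z k l s y - stress w k l s y) 2 (d * M + M * d) where
  meas := ((hz.stress_source k l).sub (hw.stress_source k l)).meas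
  decay := (hw.velocity.coord k).mul_sub_mul (hz.velocity.coord l) (h.velocity.coord k)
    (h.velocity.coord l)
  exponent_le := by simp

theorem Admissible.flux_sub_source (hz : Admissible M z) (hw : Admissible M w)
    (h : FlowBound d (z - w)) (k : Fin 3) :
    DuhamelSource (fun s y => flux z k s y - flux w k s y) 4 (d * M + M * d) where
  meas := ((hz.flux_source k).sub (hw.flux_source k)).meas
  decay := hw.temperature.mul_sub_mul (hz.velocity.coord k) h.temperature (h.velocity.coord k)
  exponent_le := by simp

end Sources

section SumDuhamel

variable {V E ι : Type*} [NormedAddCommGroup V] [NormedSpace ℝ V] [MeasureSpace V]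
  [NormedAddCommGroup E] [NormedSpace ℝ E] [Fintype ι]

theorem DuhamelKernel.coord {K : ℝ → V → E3} {t c : ℝ} (hK : DuhamelKernel K t c) (j : Fin 3) :
    DuhamelKernel (fun τ z => K τ z j) t c where
  meas := (EuclideanSpace.proj j : E3 →L[ℝ] ℝ).continuous.comp_stronglyMeasurable hK.meas
  bound := fun τ hτ z => (PiLp.norm_apply_le _ j).trans (hK.bound τ hτ z)

variable [FiniteDimensional ℝ V] [BorelSpace V] [(volume : Measure V).IsAddHaarMeasure]

theorem duhamel_apply {K : ℝ → V → E3} {F : ℝ → V → ℝ} {p : ℕ} {t c D : ℝ}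
    (hK : DuhamelKernel K t c) (hF : DuhamelSource F p D) (x : V) (j : Fin 3) :
    duhamel K F t x j = duhamel (fun τ z => K τ z j) F t x :=
  eval_integral_piLp (fun i => (integrable_duhamel_integrand hK hF x).eval_piLp i) j

theorem integral_integral_sum_eq_sum_duhamel {K : ι → ℝ → V → E} {F : ι → ℝ → V → ℝ} {p : ℕ}
    {t c D : ℝ} (hK : ∀ i, DuhamelKernel (K i) t c) (hF : ∀ i, DuhamelSource (F i) p D) (x : V) :
    ∫ s in Ioo 0 t, ∫ y, ∑ i, F i s y • K i (t - s) (x - y) = ∑ i, duhamel (K i) (F i) t x := by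
  have hint := fun i => integrable_duhamel_integrand (hK i) (hF i) x
  calc _ = ∫ q, ∑ i, F i q.1 q.2 • K i (t - q.1) (x - q.2) ∂slab V t :=
        (integral_prod _ (integrable_finsetSum _ fun i _ => hint i)).symm
    _ = _ := integral_finsetSum _ fun i _ => hint i

theorem parabolicDecay_neg_sum_duhamel_sub {K : ι → ℝ → V → E} {F G : ι → ℝ → V → ℝ} {n p : ℕ}
    {c : ℝ → ℝ} {A C D : ℝ} (hK : ∀ i t, DuhamelKernel (K i) t (c t))
    (hF : ∀ i, DuhamelSource (F i) p C) (hG : ∀ i, DuhamelSource (G i) p D)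
    (hA : ∀ i, ParabolicDecay (duhamel (K i) fun s y => F i s y - G i s y) n A) :
    ParabolicDecay (fun t x => -∑ i, duhamel (K i) (F i) t x - -∑ i, duhamel (K i) (G i) t x) n
      (Fintype.card ι * A) := by
  have hsub (t : ℝ) (x : V) : -∑ i, duhamel (K i) (F i) t x - -∑ i, duhamel (K i) (G i) t x
      = -∑ i, duhamel (K i) (fun s y => F i s y - G i s y) t x := by
    simp only [duhamel_sub (hK _ t) (hF _) (hG _), Finset.sum_sub_distrib]
    abel
  simp only [hsub]
  exact .neg_sum hA

end SumDuhamel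

section Nonlinearity

variable {M d : ℝ} {z w : Flow}

theorem termB_eq (hz : Admissible M z) (t : ℝ) (x : E3) :
    termB z.1 t x
      = -∑ p : Fin 3 × Fin 3, duhamel (oseenGrad p.1 p.2) (stress z p.1 p.2) t x := by
  obtain ⟨c, hc⟩ := exists_duhamelKernel_grad
  have hK := fun p : Fin 3 × Fin 3 => (hc t).1 p.1 p.2
  have hF := fun p : Fin 3 × Fin 3 => hz.stress_source p.1 p.2
  ext j
  simp only [termB, PiLp.neg_apply, WithLp.ofLp_sum, Finset.sum_apply,
    duhamel_apply (hK _) (hF _),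
    ← integral_integral_sum_eq_sum_duhamel (fun p => (hK p).coord j) hF]
  congr 1
  refine setIntegral_congr_fun measurableSet_Ioo fun s hs => ?_
  simp only [pd_oseenKernel _ _ _ (sub_pos.2 hs.2), Fintype.sum_prod_type, stress, smul_eq_mul,
    mul_comm]

theorem termE_eq (hz : Admissible M z) (t : ℝ) (x : E3) :
    termE z.1 z.2 t x
      = -∑ k, duhamel (fun τ y => τ • oseenGrad k 2 τ y) (flux z k) t x := by
  obtain ⟨c, hc⟩ := exists_duhamelKernel_grad
  have hK := fun k => ((hc t).1 k 2).time_smul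
  ext j
  simp only [termE, PiLp.neg_apply, WithLp.ofLp_sum, Finset.sum_apply,
    duhamel_apply (hK _) (hz.flux_source _),
    ← integral_integral_sum_eq_sum_duhamel (fun k => (hK k).coord j) hz.flux_source]
  congr 1
  refine setIntegral_congr_fun measurableSet_Ioo fun s hs => ?_
  simp only [pd_oseenKernel _ _ _ (sub_pos.2 hs.2), ← integral_const_mul, Finset.mul_sum, flux,
    smul_eq_mul, PiLp.smul_apply, mul_comm, mul_left_comm]

theorem termBt_eq (hz : Admissible M z) (t : ℝ) (x : E3) :
    termBt z.2 z.1 t x = -∑ k, duhamel (heatGrad k) (flux z k) t x := by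
  obtain ⟨c, hc⟩ := exists_duhamelKernel_grad
  rw [termBt, ← integral_integral_sum_eq_sum_duhamel (hc t).2 hz.flux_source]
  congr 1
  refine setIntegral_congr_fun measurableSet_Ioo fun s hs => ?_
  simp only [pd_heatKernel _ (sub_pos.2 hs.2), flux, smul_eq_mul, mul_comm]

theorem boundedSolenoidal_nonlinearity (hz : Admissible M z) {t : ℝ} (ht : 0 < t) :
    BoundedSolenoidal ((nonlinearity z).1 t) := by
  obtain ⟨c, hc⟩ := exists_duhamelKernel_grad
  have hdiv := fun k (l : Fin 3) τ (hτ : 0 < τ) => isDivFree_oseenColumn_lineDeriv k l hτ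
  have hB := BoundedSolenoidal.sum Finset.univ fun p : Fin 3 × Fin 3 =>
    boundedSolenoidal_duhamel ht ((hc t).1 p.1 p.2) (hz.stress_source p.1 p.2) (hdiv p.1 p.2)
  have hE := BoundedSolenoidal.sum Finset.univ fun k =>
    boundedSolenoidal_duhamel ht ((hc t).1 k 2).time_smul (hz.flux_source k)
      fun τ hτ => (hdiv k 2 τ hτ).const_smul τ
  convert (hB.add hE).smul (-1) using 1
  funext x
  simp only [nonlinearity, termB_eq hz, termE_eq hz, neg_smul, one_smul, neg_add]

theorem stronglyMeasurable_smul_oseenGrad (k l : Fin 3) :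
    StronglyMeasurable (Function.uncurry fun τ y => τ • oseenGrad k l τ y) :=
  measurable_fst.stronglyMeasurable.smul (g := Function.uncurry (oseenGrad k l))
    (stronglyMeasurable_oseenGrad k l)

theorem aestronglyMeasurable_nonlinearity_fst (hz : Admissible M z) :
    AEStronglyMeasurable (Function.uncurry (nonlinearity z).1) (spaceTime E3) := by
  have hB := Finset.univ.aestronglyMeasurable_fun_sum fun (p : Fin 3 × Fin 3) _ =>
    aestronglyMeasurable_duhamel (stronglyMeasurable_oseenGrad p.1 p.2)
      (hz.stress_source p.1 p.2).meas
  have hE := Finset.univ.aestronglyMeasurable_fun_sum fun (k : Fin 3) _ =>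
    aestronglyMeasurable_duhamel (stronglyMeasurable_smul_oseenGrad k 2) (hz.flux_source k).meas
  exact (hB.neg.add hE.neg).congr (.of_forall fun q =>
    congrArg₂ (· + ·) (termB_eq hz q.1 q.2).symm (termE_eq hz q.1 q.2).symm)

theorem aestronglyMeasurable_nonlinearity_snd (hz : Admissible M z) :
    AEStronglyMeasurable (Function.uncurry (nonlinearity z).2) (spaceTime E3) := by
  have hBt := Finset.univ.aestronglyMeasurable_fun_sum fun (k : Fin 3) _ =>
    aestronglyMeasurable_duhamel (stronglyMeasurable_heatGrad k) (hz.flux_source k).meas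
  exact hBt.neg.congr (.of_forall fun q => (termBt_eq hz q.1 q.2).symm)

/-- The bilinear estimate `‖Q z - Q w‖ ≤ L M ‖z - w‖` in `𝓧 × 𝓨`, for `z`, `w` in the ball of
radius `M`, where `Q` is the quadratic part of the mild formulation. -/
def BilinearBound (L : ℝ) : Prop :=
  ∀ M d z w, Admissible M z → Admissible M w → FlowBound d (z - w) →
    FlowBound (L * M * d) (nonlinearity z - nonlinearity w)

theorem exists_bilinearBound : ∃ L > 0, BilinearBound L := by
  obtain ⟨c, hc⟩ := exists_duhamelKernel_grad
  have hK := fun t => (hc t).1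
  have hK' := fun t => (hc t).2
  have hcnonneg : 0 ≤ c := (hK' 1 0).const_nonneg one_pos
  have hD := duhamelConst_nonneg (V := E3)
  refine ⟨24 * (duhamelConst E3 * c) + 1, by positivity, fun M d z w hz hw hzw => ?_⟩
  set A := duhamelConst E3 * c * (d * M + M * d) with hA
  have hB : ParabolicDecay (fun t x => termB z.1 t x - termB w.1 t x) 1
      (Fintype.card (Fin 3 × Fin 3) * A) := by
    simp only [termB_eq hz, termB_eq hw]
    exact parabolicDecay_neg_sum_duhamel_sub (fun p t => hK t p.1 p.2)
      (fun p => hz.stress_source p.1 p.2) (fun p => hw.stress_source p.1 p.2) fun p =>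
        parabolicDecay_duhamel (fun t => hK t p.1 p.2) (hz.stress_sub_source hw hzw p.1 p.2)
  have hE : ParabolicDecay (fun t x => termE z.1 z.2 t x - termE w.1 w.2 t x) 1
      (Fintype.card (Fin 3) * A) := by
    simp only [termE_eq hz, termE_eq hw]
    exact parabolicDecay_neg_sum_duhamel_sub (fun k t => (hK t k 2).time_smul)
      hz.flux_source hw.flux_source fun k =>
        parabolicDecay_duhamel_time_smul (fun t => hK t k 2) (hz.flux_sub_source hw hzw k)
  have hBt : ParabolicDecay (fun t x => termBt z.2 z.1 t x - termBt w.2 w.1 t x) 3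
      (Fintype.card (Fin 3) * A) := by
    simp only [termBt_eq hz, termBt_eq hw]
    exact parabolicDecay_neg_sum_duhamel_sub (fun k t => hK' t k)
      hz.flux_source hw.flux_source fun k =>
        parabolicDecay_duhamel (fun t => hK' t k) (hz.flux_sub_source hw hzw k)
  have hMd : 0 ≤ M * d := mul_nonneg hz.nonneg hzw.nonneg
  have hA_nonneg : 0 ≤ A := by rw [hA, mul_comm d]; positivity
  have hconst : 12 * A ≤ (24 * (duhamelConst E3 * c) + 1) * M * d := by rw [hA]; nlinarith
  refine ⟨ParabolicDecay.mono ?_ hconst, hBt.mono (by norm_num; linarith)⟩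
  convert hB.add hE using 1
  · funext t x
    exact add_sub_add_comm ..
  · norm_num
    ring

end Nonlinearity

/-! ### The fixed point -/

section Limit

variable {V F : Type*} [NormedAddCommGroup V] [NormedAddCommGroup F] {p : ℕ} {B C : ℝ}

theorem tendsto_const_div_two_pow (C : ℝ) : Tendsto (fun n : ℕ => C / 2 ^ n) atTop (𝓝 0) :=
  tendsto_const_nhds.div_atTop (tendsto_pow_atTop_atTop_of_one_lt one_lt_two)

theorem ParabolicDecay.of_forall_add_div_two_pow {f : ℝ → V → F}
    (h : ∀ n : ℕ, ParabolicDecay f p (B + C / 2 ^ n)) : ParabolicDecay f p B := fun t ht x => by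
  have hlim := ((tendsto_const_div_two_pow C).const_add B).mul_const ((√t + ‖x‖) ^ p)⁻¹
  rw [add_zero] at hlim
  exact ge_of_tendsto' hlim fun n => h n t ht x

theorem tendsto_of_parabolicDecay_sub {f : ℕ → ℝ → V → F} {g : ℝ → V → F}
    (h : ∀ n, ParabolicDecay (f n - g) p (C / 2 ^ n)) {t : ℝ} (ht : 0 < t) (x : V) :
    Tendsto (fun n => f n t x) atTop (𝓝 (g t x)) := by
  rw [tendsto_iff_norm_sub_tendsto_zero]
  refine squeeze_zero (fun _ => norm_nonneg _) (fun n => h n t ht x) ?_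
  simpa using (tendsto_const_div_two_pow C).mul_const ((√t + ‖x‖) ^ p)⁻¹

theorem exists_parabolicDecay_sub_of_geometric [CompleteSpace F] {f : ℕ → ℝ → V → F}
    (h : ∀ n, ParabolicDecay (f n - f (n + 1)) p (C / 2 / 2 ^ n)) :
    ∃ g : ℝ → V → F, ∀ n, ParabolicDecay (f n - g) p (C / 2 ^ n) := by
  refine ⟨fun t x => limUnder atTop fun n => f n t x, fun n t ht x => ?_⟩
  have hdist (n : ℕ) : dist (f n t x) (f (n + 1) t x) ≤ C * ((√t + ‖x‖) ^ p)⁻¹ / 2 / 2 ^ n := by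
    rw [dist_eq_norm]
    exact (h n t ht x).trans_eq (by ring)
  have hlim := (cauchySeq_of_le_geometric_two hdist).tendsto_limUnder
  have := dist_le_of_le_geometric_two_of_tendsto hdist hlim n
  rw [dist_eq_norm] at this
  exact this.trans_eq (by ring)

end Limit

section FixedPoint

variable {M d c : ℝ} {z w : Flow} {T : Flow → Flow}

theorem FlowBound.mono (h : FlowBound c z) (hcd : c ≤ d) : FlowBound d z :=
  ⟨h.velocity.mono hcd, h.temperature.mono hcd⟩

theorem FlowBound.add (hz : FlowBound c z) (hw : FlowBound d w) : FlowBound (c + d) (z + w) :=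
  ⟨hz.velocity.add hw.velocity, hz.temperature.add hw.temperature⟩

theorem FlowBound.sub (hz : FlowBound c z) (hw : FlowBound d w) : FlowBound (c + d) (z - w) :=
  ⟨hz.velocity.sub hw.velocity, hz.temperature.sub hw.temperature⟩

theorem FlowBound.of_forall_add_div_two_pow (h : ∀ n : ℕ, FlowBound (c + d / 2 ^ n) z) :
    FlowBound c z :=
  ⟨.of_forall_add_div_two_pow fun n => (h n).velocity,
    .of_forall_add_div_two_pow fun n => (h n).temperature⟩

theorem flowBound_zero_iff : FlowBound 0 z ↔ ∀ t, 0 < t → ∀ x, z.1 t x = 0 ∧ z.2 t x = 0 := by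
  refine ⟨fun h t ht x => ⟨?_, ?_⟩, fun h => ⟨fun t ht x => ?_, fun t ht x => ?_⟩⟩
  · simpa using h.velocity t ht x
  · simpa using h.temperature t ht x
  · simp [(h t ht x).1]
  · simp [(h t ht x).2]

theorem admissible_zero (hM : 0 ≤ M) : Admissible M 0 where
  velocity := fun t _ x => by
    rw [Prod.fst_zero, Pi.zero_apply, Pi.zero_apply, norm_zero]
    positivity
  temperature := fun t _ x => by
    rw [Prod.snd_zero, Pi.zero_apply, Pi.zero_apply, norm_zero]
    positivity
  measVelocity := aestronglyMeasurable_zero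
  measTemperature := aestronglyMeasurable_zero

theorem Admissible.of_tendsto {a : ℕ → Flow} (ha : ∀ n, Admissible M (a n))
    (h : ∀ n, FlowBound (c / 2 ^ n) (a n - z)) : Admissible M z where
  toFlowBound := .of_forall_add_div_two_pow fun n => by
    simpa using (ha n).toFlowBound.sub (h n)
  measVelocity := by
    refine aestronglyMeasurable_of_tendsto_ae atTop (fun n => (ha n).measVelocity) ?_
    filter_upwards [ae_spaceTime_pos] with q hq using
      tendsto_of_parabolicDecay_sub (fun n => (h n).velocity) hq q.2
  measTemperature := by
    refine aestronglyMeasurable_of_tendsto_ae atTop (fun n => (ha n).measTemperature) ?_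
    filter_upwards [ae_spaceTime_pos] with q hq using
      tendsto_of_parabolicDecay_sub (fun n => (h n).temperature) hq q.2

/-- `T` maps the ball of radius `M` of `𝓧 × 𝓨` to itself and halves distances there. -/
structure HalfContraction (M : ℝ) (T : Flow → Flow) : Prop where
  mapsTo : ∀ z, Admissible M z → Admissible M (T z)
  dist_le : ∀ d z w, Admissible M z → Admissible M w → FlowBound d (z - w) →
    FlowBound (d / 2) (T z - T w)

theorem HalfContraction.eq_of_fixed (hT : HalfContraction M T) (hz : Admissible M z)
    (hw : Admissible M w) (hTz : FlowBound 0 (T z - z)) (hTw : FlowBound 0 (T w - w)) :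
    FlowBound 0 (z - w) := by
  refine .of_forall_add_div_two_pow (d := M + M) fun n => ?_
  rw [zero_add]
  induction n with
  | zero => simpa using hz.toFlowBound.sub hw.toFlowBound
  | succ n ih =>
    convert (hT.dist_le _ z w hz hw ih).sub (hTz.sub hTw) using 1
    · ring
    · abel

theorem HalfContraction.exists_fixed (hT : HalfContraction M T) (hM : 0 ≤ M) :
    ∃ z, Admissible M z ∧ FlowBound 0 (T z - z) := by
  let a (n : ℕ) : Flow := T^[n] 0
  have hsucc (n : ℕ) : a (n + 1) = T (a n) := Function.iterate_succ_apply' T n 0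
  have ha (n : ℕ) : Admissible M (a n) := by
    induction n with
    | zero => exact admissible_zero hM
    | succ n ih => exact hsucc n ▸ hT.mapsTo _ ih
  have hstep (n : ℕ) : FlowBound ((M + M) * 2 / 2 / 2 ^ n) (a n - a (n + 1)) := by
    induction n with
    | zero => simpa using (ha 0).toFlowBound.sub (ha 1).toFlowBound
    | succ n ih =>
      have := hT.dist_le _ _ _ (ha n) (ha (n + 1)) ih
      rwa [← hsucc, ← hsucc, div_div, ← pow_succ] at this
  obtain ⟨u, hu⟩ := exists_parabolicDecay_sub_of_geometric fun n => (hstep n).velocity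
  obtain ⟨θ, hθ⟩ := exists_parabolicDecay_sub_of_geometric fun n => (hstep n).temperature
  have hlim (n : ℕ) : FlowBound ((M + M) * 2 / 2 ^ n) (a n - (u, θ)) := ⟨hu n, hθ n⟩
  have hz := Admissible.of_tendsto ha hlim
  refine ⟨(u, θ), hz, .of_forall_add_div_two_pow (d := (M + M) * 2) fun n => ?_⟩
  convert (hlim (n + 1)).sub (hT.dist_le _ _ _ (ha n) hz (hlim n)) using 1
  · ring
  · rw [hsucc]
    abel

end FixedPoint

section Mild

variable {u₀ : E3 → E3} {θ₀ : RealTempered} {L M ε : ℝ} {z : Flow}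

/-- The evolution `(e^{tΔ} u₀ + t e^{tΔ} ℙ(θ₀ e₃), e^{tΔ} θ₀)` of the data under the linearised
system. -/
def freeFlow (u₀ : E3 → E3) (θ₀ : RealTempered) : Flow :=
  (fun t x => heatFlow u₀ t x + t • lerayHeatFlowDistr θ₀ t x, heatFlowDistr θ₀)

/-- The map whose fixed points are the mild solutions with data `(u₀, θ₀)`. -/
def mildMap (u₀ : E3 → E3) (θ₀ : RealTempered) (z : Flow) : Flow :=
  freeFlow u₀ θ₀ + nonlinearity z

/-- The hypotheses on the data `(u₀, θ₀)`, with the norms bounded by `ε`. -/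
structure SmallData (ε : ℝ) (u₀ : E3 → E3) (θ₀ : RealTempered) : Prop where
  velocity : CriticalField u₀ ε
  divFree : IsDivFree u₀
  buoyancy : ParabolicDecay (fun t x => t • lerayHeatFlowDistr θ₀ t x) 1 ε
  temperature : ParabolicDecay (heatFlowDistr θ₀) 3 ε

theorem isMildSolution_iff :
    IsMildSolution u₀ θ₀ z.1 z.2 ↔ FlowBound 0 (mildMap u₀ θ₀ z - z) := by
  rw [flowBound_zero_iff]
  refine forall_congr' fun t => forall_congr' fun _ => forall_congr' fun x => and_congr ?_ ?_
  · rw [add_assoc]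
    exact eq_comm.trans sub_eq_zero.symm
  · exact eq_comm.trans sub_eq_zero.symm

theorem nonlinearity_zero : nonlinearity 0 = 0 := by
  ext <;> simp [nonlinearity, termB, termE, termBt]

theorem halfContraction_mildMap (hL : BilinearBound L) (hLM : L * M ≤ 1 / 2)
    (hfree : Admissible (M / 2) (freeFlow u₀ θ₀)) : HalfContraction M (mildMap u₀ θ₀) where
  mapsTo z hz := by
    have hM : 0 ≤ M := by linarith [hfree.nonneg]
    have hQ : FlowBound (L * M * M) (nonlinearity z) := by
      simpa [nonlinearity_zero] using
        hL M M z 0 hz (admissible_zero hM) (by simpa using hz.toFlowBound)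
    exact
      { toFlowBound := (hfree.toFlowBound.add hQ).mono (by nlinarith)
        measVelocity := hfree.measVelocity.add (aestronglyMeasurable_nonlinearity_fst hz)
        measTemperature := hfree.measTemperature.add (aestronglyMeasurable_nonlinearity_snd hz) }
  dist_le d z w hz hw hzw := by
    rw [mildMap, mildMap, add_sub_add_left_eq_sub]
    exact (hL M d z w hz hw hzw).mono (by nlinarith [hzw.nonneg])

theorem exists_admissible_freeFlow : ∃ H > 0, ∀ ε u₀ θ₀, SmallData ε u₀ θ₀ →
    Admissible (H * ε) (freeFlow u₀ θ₀) := by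
  obtain ⟨C, hC, hheat⟩ := exists_parabolicDecay_heatFlow
  refine ⟨C + 1, by positivity, fun ε u₀ θ₀ h => ?_⟩
  have hε := h.temperature.const_nonneg
  exact
    { velocity := ((hheat u₀ ε h.velocity).add h.buoyancy).mono (by linarith)
      temperature := h.temperature.mono (by nlinarith)
      measVelocity := (aestronglyMeasurable_heatFlow h.velocity.meas).add
        (measurable_fst.aestronglyMeasurable.smul
          (aestronglyMeasurable_lerayHeatFlowDistr h.temperature))
      measTemperature := (measurable_heatFlowDistr θ₀).aestronglyMeasurable }

theorem isDivFree_of_isMildSolution (h : SmallData ε u₀ θ₀) (hz : Admissible M z)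
    (hsol : IsMildSolution u₀ θ₀ z.1 z.2) {t : ℝ} (ht : 0 < t) : IsDivFree (z.1 t) := by
  convert ((boundedSolenoidal_heatFlow h.velocity h.divFree ht).add
    ((boundedSolenoidal_lerayHeatFlowDistr h.temperature ht).smul t)).add
      (boundedSolenoidal_nonlinearity hz ht) |>.divFree using 1
  exact funext fun x => (hsol t ht x).1.trans (add_assoc ..)

end Mild

section Norms

variable {u₀ : E3 → E3} {θ₀ : RealTempered} {u : ℝ → E3 → E3} {θ : ℝ → E3 → ℝ} {M ε : ℝ}

theorem ofReal_mul_enorm_le_iff {F : Type*} [SeminormedAddCommGroup F] {a : ℝ} (ha : 0 ≤ a)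
    (hM : 0 ≤ M) (v : F) : ENNReal.ofReal a * ‖v‖ₑ ≤ ENNReal.ofReal M ↔ a * ‖v‖ ≤ M := by
  rw [← ofReal_norm, ← ENNReal.ofReal_mul ha, ENNReal.ofReal_le_ofReal_iff hM]

theorem parabolicDecay_iff_iSup_le {V F : Type*} [NormedAddCommGroup V] [NormedAddCommGroup F]
    (f : ℝ → V → F) (n : ℕ) (hM : 0 ≤ M) :
    ⨆ (t : ℝ) (_ : 0 < t) (x : V), ENNReal.ofReal ((√t + ‖x‖) ^ n) * ‖f t x‖ₑ ≤ ENNReal.ofReal M ↔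
      ParabolicDecay f n M := by
  simp only [iSup_le_iff]
  refine forall_congr' fun t => forall_congr' fun ht => forall_congr' fun x => ?_
  have := Real.sqrt_pos.2 ht
  rw [ofReal_mul_enorm_le_iff (by positivity) hM, ← div_eq_mul_inv, le_div_iff₀' (by positivity)]

theorem normX_le_iff (hM : 0 ≤ M) : normX u ≤ ENNReal.ofReal M ↔ ParabolicDecay u 1 M := by
  simpa only [normX, pow_one] using parabolicDecay_iff_iSup_le u 1 hM

theorem normY_le_iff (hM : 0 ≤ M) : normY θ ≤ ENNReal.ofReal M ↔ ParabolicDecay θ 3 M :=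
  parabolicDecay_iff_iSup_le θ 3 hM

theorem admissible_iff (hM : 0 ≤ M) : Admissible M (u, θ) ↔
    MemX u ∧ MemY θ ∧ normX u ≤ ENNReal.ofReal M ∧ normY θ ≤ ENNReal.ofReal M := by
  rw [normX_le_iff hM, normY_le_iff hM]
  refine ⟨fun h => ⟨⟨h.measVelocity, ?_⟩, ⟨h.measTemperature, ?_⟩, h.velocity, h.temperature⟩,
    fun ⟨hu, hθ, hdu, hdθ⟩ => ⟨⟨hdu, hdθ⟩, hu.1, hθ.1⟩⟩
  · exact ((normX_le_iff hM).2 h.velocity).trans_lt ENNReal.ofReal_lt_top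
  · exact ((normY_le_iff hM).2 h.temperature).trans_lt ENNReal.ofReal_lt_top

theorem smallData_of_norms_lt (hε : 0 ≤ ε) (hm : AEStronglyMeasurable u₀ volume)
    (hdiv : IsDivFree u₀) (hu₀ : (⨆ x : E3, ‖x‖ₑ * ‖u₀ x‖ₑ) < ENNReal.ofReal ε)
    (hler : normX (fun t x => t • lerayHeatFlowDistr θ₀ t x) < ENNReal.ofReal ε)
    (hθ : normY (heatFlowDistr θ₀) < ENNReal.ofReal ε) : SmallData ε u₀ θ₀ where
  velocity := ⟨hm, fun y => (ofReal_mul_enorm_le_iff (norm_nonneg y) hε _).1 <| by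
    rw [ofReal_norm]
    exact (le_iSup (fun x => ‖x‖ₑ * ‖u₀ x‖ₑ) y).trans hu₀.le⟩
  divFree := hdiv
  buoyancy := (normX_le_iff hε).1 hler.le
  temperature := (normY_le_iff hε).1 hθ.le

end Norms

end Boussinesq

end

theorem theorem3p1 :
    ∃ ε₀ : ℝ, 0 < ε₀ ∧ ∃ C : ℝ, 0 < C ∧ ∀ ε : ℝ, 0 < ε → ε ≤ ε₀ →
      ∀ (u₀ : Boussinesq.E3 → Boussinesq.E3) (θ₀ : Boussinesq.RealTempered),
        AEStronglyMeasurable u₀ volume →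
        Boussinesq.IsDivFree u₀ →
        (⨆ x : Boussinesq.E3, ‖x‖ₑ * ‖u₀ x‖ₑ) < ENNReal.ofReal ε →
        Boussinesq.normX (fun t x => t • Boussinesq.lerayHeatFlowDistr θ₀ t x)
          < ENNReal.ofReal ε →
        Boussinesq.normY (Boussinesq.heatFlowDistr θ₀) < ENNReal.ofReal ε →
        ∃ (u : ℝ → Boussinesq.E3 → Boussinesq.E3) (θ : ℝ → Boussinesq.E3 → ℝ),
          Boussinesq.MemX u ∧ Boussinesq.MemY θ ∧
          Boussinesq.IsMildSolution u₀ θ₀ u θ ∧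
          Boussinesq.normX u ≤ ENNReal.ofReal (C * ε) ∧
          Boussinesq.normY θ ≤ ENNReal.ofReal (C * ε) ∧
          (∀ t : ℝ, 0 < t → Boussinesq.IsDivFree (u t)) ∧
          ∀ (v : ℝ → Boussinesq.E3 → Boussinesq.E3) (η : ℝ → Boussinesq.E3 → ℝ),
            Boussinesq.MemX v → Boussinesq.MemY η →
            Boussinesq.IsMildSolution u₀ θ₀ v η →
            Boussinesq.normX v ≤ ENNReal.ofReal (C * ε) →
            Boussinesq.normY η ≤ ENNReal.ofReal (C * ε) →
            ∀ t : ℝ, 0 < t → ∀ x : Boussinesq.E3, v t x = u t x ∧ η t x = θ t x := by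
  obtain ⟨L, hL0, hL⟩ := Boussinesq.exists_bilinearBound
  obtain ⟨H, hH0, hH⟩ := Boussinesq.exists_admissible_freeFlow
  refine ⟨1 / (4 * L * H), by positivity, 2 * H, by positivity,
    fun ε hε hεle u₀ θ₀ hm hdiv hu₀ hler hθ₀ => ?_⟩
  have hM : 0 ≤ 2 * H * ε := by positivity
  have hLM : L * (2 * H * ε) ≤ 1 / 2 := by
    rw [le_div_iff₀ (by positivity)] at hεle
    linarith
  have hdata := Boussinesq.smallData_of_norms_lt hε.le hm hdiv hu₀ hler hθ₀
  have hfree : Boussinesq.Admissible (2 * H * ε / 2) (Boussinesq.freeFlow u₀ θ₀) := by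
    convert hH ε u₀ θ₀ hdata using 1
    ring
  have hT := Boussinesq.halfContraction_mildMap hL hLM hfree
  obtain ⟨⟨u, θ⟩, hadm, hfix⟩ := hT.exists_fixed hM
  obtain ⟨hu, hθ, hX, hY⟩ := (Boussinesq.admissible_iff hM).1 hadm
  have hsol := Boussinesq.isMildSolution_iff.2 hfix
  refine ⟨u, θ, hu, hθ, hsol, hX, hY,
    fun t ht => Boussinesq.isDivFree_of_isMildSolution hdata hadm hsol ht,
    fun v η hv hη hsol' hX' hY' t ht x => ?_⟩
  have hdiff := hT.eq_of_fixed ((Boussinesq.admissible_iff hM).2 ⟨hv, hη, hX', hY'⟩) hadm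
    (Boussinesq.isMildSolution_iff (z := (v, η)) |>.1 hsol') hfix
  exact (Boussinesq.flowBound_zero_iff.1 hdiff t ht x).imp sub_eq_zero.1 sub_eq_zero.1
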